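/- Let $M$ be a simply connected smooth manifold (Hausdorff, second countable, finite-dimensional, without boundary), let $\mathcal F$ be a regular smooth foliation of $M$, given by a foliated atlas, and let $D\subset TM$ be its tangent distribution, so that the space $\Gamma(D)$ of smooth vector fields tangent to $\mathcal F$ is a Lie subalgebra of the space $\Gamma(TM)$ of smooth vector fields. An action of a finite-dimensional real Lie algebra $\mathfrak g_0$ on $M$ is a Lie algebra homomorphism $\mathfrak g_0\to\Gamma(TM)$, $\xi\mapsto\#\xi$, into the vector fields with the Jacobi–Lie bracket. Its orbit through $m$ consists of the points that can be joined to $m$ by finitely many $C^1$ paths $\gamma$, each of the form $\dot\gamma(t)=(\#\xi(t))(\gamma(t))$ with a continuous path $\xi$ in $\mathfrak g_0$; it is an immersed submanifold with tangent space $\{(\#\xi)(m):\xi\in\mathfrak g_0\}$ at $m$. The action is free if all orbits have the dimension of $\mathfrak g_0$. An affine connection on $D$ is an $\mathbb R$-bilinear map $(V,X)\mapsto\nabla_VX$, $\Gamma(TM)\times\Gamma(D)\to\Gamma(D)$, with $\nabla_{fV}X=f\nabla_VX$ and $\nabla_V(fX)=f\nabla_VX+df(V)X$ for all smooth functions $f$;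 it is flat if $\nabla_V\nabla_WX-\nabla_W\nabla_VX-\nabla_{[V,W]}X=0$ for all $V,W\in\Gamma(TM)$, $X\in\Gamma(D)$. Its associated $D$-connection on $TM$ is $$\bar\nabla_XV:=\nabla_VX+[X,V],\qquad X\in\Gamma(D),\ V\in\Gamma(TM),$$ and $\bar\nabla$ is flat if $\bar\nabla_X\bar\nabla_YV-\bar\nabla_Y\bar\nabla_XV-\bar\nabla_{[X,Y]}V=0$ for all $X,Y\in\Gamma(D)$, $V\in\Gamma(TM)$. Then the following are equivalent: 1. There are a finite-dimensional real Lie algebra $\mathfrak g_0$ and a free action of $\mathfrak g_0$ on $M$ whose orbits are, as immersed submanifolds, the leaves of $\mathcal F$: for each $m\in M$ the orbit and the leaf through $m$ have the same points and the same tangent space at $m$. 2. $D$ admits a flat affine connection $\nabla$ whose associated $D$-connection $\bar\nabla$ is also flat. -/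

import Mathlib

open Set Filter VectorField
open scoped Manifold ContDiff Topology Bundle

noncomputable section

theorem two_le_smooth : (2 : WithTop ℕ∞) ≤ ∞ := WithTop.coe_le_coe.2 le_top

/-! ## Smooth vector fields -/

section VectorFields

variable (E : Type*) [NormedAddCommGroup E] [NormedSpace ℝ E]
  (M : Type*) [TopologicalSpace M] [ChartedSpace E M] [IsManifold 𝓘(ℝ, E) ∞ M]

/-- The space `Γ(TM)` of smooth vector fields on the manifold `M` (without boundary), modelled
on `E`. -/
abbrev SmoothVF : Type _ :=
  ContMDiffSection 𝓘(ℝ, E) E ∞ (TangentSpace 𝓘(ℝ, E) : M → Type _)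

/-- The ring of smooth real-valued functions on `M`. -/
abbrev SmoothFn : Type _ := C^∞⟮𝓘(ℝ, E), M; 𝓘(ℝ, ℝ), ℝ⟯

variable {E M}

/-- Multiplication of a vector field by a smooth function: `(f • X) x = f x • X x`. -/
instance SmoothVF.instSMulFn : SMul (SmoothFn E M) (SmoothVF E M) :=
  ⟨fun f X => ⟨fun x => f x • X x, f.contMDiff.smul_section X.contMDiff⟩⟩

theorem SmoothVF.smulFn_apply (f : SmoothFn E M) (X : SmoothVF E M) (x : M) :
    (f • X) x = f x • X x := rfl

/-- The derivative `df(V)` of the smooth function `f` along the vector field `V`, at `x`. -/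
def SmoothFn.dirDeriv (f : SmoothFn E M) (V : SmoothVF E M) (x : M) : ℝ :=
  mfderiv 𝓘(ℝ, E) 𝓘(ℝ, ℝ) f x (V x)

theorem SmoothVF.mdifferentiableAt (X : SmoothVF E M) (x : M) :
    MDifferentiableAt 𝓘(ℝ, E) 𝓘(ℝ, E).tangent
      (fun y => (⟨y, X y⟩ : TangentBundle 𝓘(ℝ, E) M)) x :=
  (X.contMDiff x).mdifferentiableAt (by simp)

variable [FiniteDimensional ℝ E]

/-- The Jacobi-Lie bracket of smooth vector fields. -/
instance SmoothVF.instBracket : Bracket (SmoothVF E M) (SmoothVF E M) where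
  bracket X Y := ⟨mlieBracket 𝓘(ℝ, E) X Y, by
    have := FiniteDimensional.complete ℝ E
    have : IsManifold 𝓘(ℝ, E) (minSmoothness ℝ 2) M := by
      rw [minSmoothness_of_isRCLikeNormedField]
      exact IsManifold.of_le (n := ∞) two_le_smooth
    have : IsManifold 𝓘(ℝ, E) (((⊤ : ℕ∞) : WithTop ℕ∞) + 1) M :=
      inferInstanceAs (IsManifold 𝓘(ℝ, E) ∞ M)
    exact ContDiff.mlieBracket_vectorField (m := ⊤) (n := ⊤) X.contMDiff Y.contMDiff
      (by simp [minSmoothness_of_isRCLikeNormedField])⟩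

theorem SmoothVF.bracket_apply (X Y : SmoothVF E M) (x : M) :
    ⁅X, Y⁆ x = mlieBracket 𝓘(ℝ, E) X Y x := rfl

instance SmoothVF.instLieRing : LieRing (SmoothVF E M) where
  add_lie X Y Z := by
    have := FiniteDimensional.complete ℝ E
    have : IsManifold 𝓘(ℝ, E) 2 M := IsManifold.of_le (n := ∞) two_le_smooth
    ext x
    exact mlieBracket_add_left (X.mdifferentiableAt x) (Y.mdifferentiableAt x)
  lie_add X Y Z := by
    have := FiniteDimensional.complete ℝ E
    have : IsManifold 𝓘(ℝ, E) 2 M := IsManifold.of_le (n := ∞) two_le_smooth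
    ext x
    exact mlieBracket_add_right (Y.mdifferentiableAt x) (Z.mdifferentiableAt x)
  lie_self X := by
    ext x
    simp [SmoothVF.bracket_apply]
  leibniz_lie X Y Z := by
    have := FiniteDimensional.complete ℝ E
    have : IsManifold 𝓘(ℝ, E) (minSmoothness ℝ 3) M := by
      rw [minSmoothness_of_isRCLikeNormedField]
      exact IsManifold.of_le (n := ∞) (WithTop.coe_le_coe.2 le_top)
    have h (W : SmoothVF E M) (x : M) := (W.contMDiff x).of_le
      (show minSmoothness ℝ 2 ≤ ∞ by
        rw [minSmoothness_of_isRCLikeNormedField]; exact two_le_smooth)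
    ext x
    exact leibniz_identity_mlieBracket_apply (h X x) (h Y x) (h Z x)

instance SmoothVF.instLieAlgebra : LieAlgebra ℝ (SmoothVF E M) where
  lie_smul c X Y := by
    have := FiniteDimensional.complete ℝ E
    have : IsManifold 𝓘(ℝ, E) 2 M := IsManifold.of_le (n := ∞) two_le_smooth
    ext x
    exact mlieBracket_const_smul_right (Y.mdifferentiableAt x)

end VectorFields

/-! ## Regular foliations -/

/-- A regular (smooth) foliation of `M`, given by a foliated atlas: a family of smooth charts with
values in `E`, covering `M`, and a linear subspace `P` of `E` such that the changes of charts
locally map slices (subsets of translates of `P`) into slices. With `E = ℝᵖ × ℝ^q` and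
`P = ℝᵖ × 0` this says that the changes of charts are locally of the form
`(x, y) ↦ (g (x, y), h y)`. The leaves have dimension `dim P`. -/
structure RegularFoliation (E : Type*) [NormedAddCommGroup E] [NormedSpace ℝ E]
    (M : Type*) [TopologicalSpace M] [ChartedSpace E M] where
  /-- The direction of the slices. -/
  slice : Submodule ℝ E
  /-- The foliated charts. -/
  charts : Set (OpenPartialHomeomorph M E)
  smooth : charts ⊆ IsManifold.maximalAtlas 𝓘(ℝ, E) ∞ M
  cover : ∀ m : M, ∃ e ∈ charts, m ∈ e.source
  compat : ∀ e ∈ charts, ∀ e' ∈ charts, ∀ z ∈ (e.symm.trans e').source,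
    ∃ U ∈ 𝓝 z, ∀ w ∈ U, ∀ w' ∈ U, w' - w ∈ slice → e' (e.symm w') - e' (e.symm w) ∈ slice

namespace RegularFoliation

section Basic

variable {E : Type*} [NormedAddCommGroup E] [NormedSpace ℝ E]
  {M : Type*} [TopologicalSpace M] [ChartedSpace E M]
  (F : RegularFoliation E M)

/-- `x` and `y` lie in a common plaque, that is, for some foliated chart `e` they lie in the same
path component of a slice of the domain of `e`. -/
def SamePlaque (x y : M) : Prop :=
  ∃ e ∈ F.charts, x ∈ e.source ∧ y ∈ e.source ∧
    JoinedIn {w | w ∈ e.target ∧ w - e x ∈ F.slice} (e x) (e y)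

/-- The leaf through `m`: all points that can be reached from `m` by a finite chain of plaques. -/
def leaf (m : M) : Set M := {y | Relation.EqvGen F.SamePlaque m y}

/-- The tangent distribution `D` of the foliation: `D m` is the space of vectors tangent at `m` to
the leaf through `m`, that is, to the plaques of the foliated charts around `m` (which all define
the same subspace of `T_m M`). -/
def tangent (m : M) : Submodule ℝ (TangentSpace 𝓘(ℝ, E) m) where
  carrier := {v | ∀ e ∈ F.charts, m ∈ e.source →
    (mfderiv 𝓘(ℝ, E) 𝓘(ℝ, E) e m v : E) ∈ F.slice}
  add_mem' hv hw e he hm := by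
    rw [map_add]
    exact F.slice.add_mem (hv e he hm) (hw e he hm)
  zero_mem' e he hm := by
    rw [map_zero]
    exact F.slice.zero_mem
  smul_mem' c v hv e he hm := by
    rw [map_smul]
    exact F.slice.smul_mem c (hv e he hm)

end Basic

variable {E : Type*} [NormedAddCommGroup E] [NormedSpace ℝ E] [FiniteDimensional ℝ E]
  {M : Type*} [TopologicalSpace M] [ChartedSpace E M] [IsManifold 𝓘(ℝ, E) ∞ M]
  (F : RegularFoliation E M)

/-- The derivative of a vector-valued map with values in a subspace has values in this subspace. -/
theorem fderiv_mem_of_eventually {P : Submodule ℝ E} {V : E → E} {z : E}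
    (h : ∀ᶠ w in 𝓝 z, V w ∈ P) (u : E) : fderiv ℝ V z u ∈ P := by
  by_cases hd : DifferentiableAt ℝ V z
  · have hP : IsClosed (P : Set E) := P.closed_of_finiteDimensional
    have hl : HasDerivAt (fun t : ℝ => V (z + t • u)) (fderiv ℝ V z u) 0 := by
      have h1 : HasDerivAt (fun t : ℝ => z + t • u) u 0 := by
        simpa using ((hasDerivAt_id (0 : ℝ)).smul_const u).const_add z
      have h2 : HasFDerivAt V (fderiv ℝ V z) (z + (0 : ℝ) • u) := by
        simpa using hd.hasFDerivAt
      exact h2.comp_hasDerivAt (0 : ℝ) h1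
    have ht := hl.tendsto_slope
    refine hP.mem_of_tendsto ht ?_
    have hc : Tendsto (fun t : ℝ => z + t • u) (𝓝[≠] 0) (𝓝 z) := by
      have : Continuous (fun t : ℝ => z + t • u) := by fun_prop
      have := this.tendsto 0
      simp only [zero_smul, add_zero] at this
      exact this.mono_left nhdsWithin_le_nhds
    filter_upwards [hc.eventually h] with t h2
    rw [slope_def_module]
    refine P.smul_mem _ (P.sub_mem h2 ?_)
    simpa using h.self_of_nhds
  · rw [fderiv_zero_of_not_differentiableAt hd]
    exact P.zero_mem

/-- The tangent distribution of a foliation is involutive. -/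
theorem bracket_mem_tangent {X Y : SmoothVF E M} (hX : ∀ m, X m ∈ F.tangent m)
    (hY : ∀ m, Y m ∈ F.tangent m) (m : M) : ⁅X, Y⁆ m ∈ F.tangent m := by
  intro e he hm
  have := FiniteDimensional.complete ℝ E
  have he' := F.smooth he
  have hd : e.MDifferentiable 𝓘(ℝ, E) 𝓘(ℝ, E) :=
    ⟨(contMDiffOn_of_mem_maximalAtlas he').mdifferentiableOn (by simp),
      (contMDiffOn_symm_of_mem_maximalAtlas he').mdifferentiableOn (by simp)⟩
  have hpull (W : Π x : M, TangentSpace 𝓘(ℝ, E) x) (w : E) (hw : w ∈ e.target) :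
      mpullback 𝓘(ℝ, E) 𝓘(ℝ, E) e.symm W w =
        mfderiv 𝓘(ℝ, E) 𝓘(ℝ, E) e (e.symm w) (W (e.symm w)) := by
    rw [mpullback_apply]
    congr 1
    refine ContinuousLinearMap.inverse_eq ?_ ?_
    · have := hd.symm_comp_deriv (e.map_target hw)
      rwa [e.right_inv hw] at this
    · exact hd.comp_symm_deriv hw
  have hz : e m ∈ e.target := e.map_source hm
  have hmem (W : SmoothVF E M) (hW : ∀ m, W m ∈ F.tangent m) :
      ∀ᶠ w in 𝓝 (e m), (mpullback 𝓘(ℝ, E) 𝓘(ℝ, E) e.symm W w : E) ∈ F.slice := by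
    filter_upwards [e.open_target.mem_nhds hz] with w hw
    rw [hpull W w hw]
    exact hW _ e he (e.map_target hw)
  have : IsManifold 𝓘(ℝ, E) (minSmoothness ℝ 2) M := by
    rw [minSmoothness_of_isRCLikeNormedField]
    exact IsManifold.of_le (n := ∞) (by exact two_le_smooth)
  have key := mpullback_mlieBracket (n := ∞) (V := X) (W := Y) (f := e.symm) (x₀ := e m)
    (I := 𝓘(ℝ, E)) (I' := 𝓘(ℝ, E)) (X.mdifferentiableAt _) (Y.mdifferentiableAt _)
    ((contMDiffAt_symm_of_mem_maximalAtlas he' hz))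
    (by rw [minSmoothness_of_isRCLikeNormedField]; exact two_le_smooth)
  rw [hpull _ _ hz, e.left_inv hm] at key
  rw [SmoothVF.bracket_apply]
  have h2 : (mlieBracket 𝓘(ℝ, E) (mpullback 𝓘(ℝ, E) 𝓘(ℝ, E) e.symm X)
      (mpullback 𝓘(ℝ, E) 𝓘(ℝ, E) e.symm Y) (e m) : E) ∈ F.slice := by
    have h3 (V W : Π x : E, TangentSpace 𝓘(ℝ, E) x) :
        mlieBracket 𝓘(ℝ, E) V W (e m) = lieBracket (E := E) ℝ V W (e m) :=
      (congrFun mlieBracketWithin_univ _).symm.trans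
        ((congrFun mlieBracketWithin_eq_lieBracketWithin _).trans
          (congrFun (lieBracketWithin_univ (E := E)) _))
    refine (congrArg (· ∈ F.slice) (h3 _ _)).mpr ?_
    exact F.slice.sub_mem (fderiv_mem_of_eventually (E := E) (hmem Y hY) _)
      (fderiv_mem_of_eventually (E := E) (hmem X hX) _)
  exact key ▸ h2

/-- The space `Γ(D)` of smooth sections of the tangent distribution `D` of the foliation. Since
`D` is involutive, it is a Lie subalgebra of `Γ(TM)`. -/
def sections : LieSubalgebra ℝ (SmoothVF E M) where
  carrier := {X | ∀ m, X m ∈ F.tangent m}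
  add_mem' hX hY m := (F.tangent m).add_mem (hX m) (hY m)
  zero_mem' m := (F.tangent m).zero_mem
  smul_mem' c _ hX m := (F.tangent m).smul_mem c (hX m)
  lie_mem' hX hY := F.bracket_mem_tangent hX hY

/-- Multiplication of a section of `D` by a smooth function. -/
instance instSMulSections : SMul (SmoothFn E M) F.sections :=
  ⟨fun f X => ⟨f • (X : SmoothVF E M), fun m => (F.tangent m).smul_mem (f m) (X.2 m)⟩⟩

/-- An affine (i.e. linear) connection `∇ : Γ(TM) × Γ(D) → Γ(D)` on the vector bundle `D`. -/
structure Connection where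
  /-- The covariant derivative `∇_V X`. -/
  cov : SmoothVF E M → F.sections → F.sections
  add_left : ∀ (V W : SmoothVF E M) (X : F.sections), cov (V + W) X = cov V X + cov W X
  smul_left : ∀ (f : SmoothFn E M) (V : SmoothVF E M) (X : F.sections), cov (f • V) X = f • cov V X
  add_right : ∀ (V : SmoothVF E M) (X Y : F.sections), cov V (X + Y) = cov V X + cov V Y
  leibniz : ∀ (f : SmoothFn E M) (V : SmoothVF E M) (X : F.sections) (m : M),
    (cov V (f • X) : SmoothVF E M) m =
      f m • (cov V X : SmoothVF E M) m + f.dirDeriv V m • (X : SmoothVF E M) m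

namespace Connection

variable {F}

/-- The connection `∇` on `D` is flat: its curvature vanishes. -/
def IsFlat (C : F.Connection) : Prop :=
  ∀ (V W : SmoothVF E M) (X : F.sections),
    C.cov V (C.cov W X) - C.cov W (C.cov V X) - C.cov ⁅V, W⁆ X = 0

/-- The `D`-connection `∇̄_X V = ∇_V X + [X, V]` on `TM` associated with `∇`. -/
def bar (C : F.Connection) (X : F.sections) (V : SmoothVF E M) : SmoothVF E M :=
  (C.cov V X : SmoothVF E M) + ⁅(X : SmoothVF E M), V⁆

/-- The `D`-connection `∇̄` on `TM` is flat. -/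
def BarIsFlat (C : F.Connection) : Prop :=
  ∀ (X Y : F.sections) (V : SmoothVF E M),
    C.bar X (C.bar Y V) - C.bar Y (C.bar X V) - C.bar ⁅X, Y⁆ V = 0

end Connection

end RegularFoliation

/-! ## Infinitesimal Lie algebra actions -/

section Actions

variable {E : Type*} [NormedAddCommGroup E] [NormedSpace ℝ E] [FiniteDimensional ℝ E]
  {M : Type*} [TopologicalSpace M] [ChartedSpace E M] [IsManifold 𝓘(ℝ, E) ∞ M]
  {𝔤 : Type*} [LieRing 𝔤] [LieAlgebra ℝ 𝔤]

/-- An action of the Lie algebra `𝔤` on `M`: a Lie algebra homomorphism `𝔤 → Γ(TM)`. For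
finite-dimensional `𝔤` the action map `𝔤 × M → TM` is then automatically smooth. -/
abbrev LieAlgAction (𝔤 : Type*) [LieRing 𝔤] [LieAlgebra ℝ 𝔤]
    (E : Type*) [NormedAddCommGroup E] [NormedSpace ℝ E] [FiniteDimensional ℝ E]
    (M : Type*) [TopologicalSpace M] [ChartedSpace E M] [IsManifold 𝓘(ℝ, E) ∞ M] : Type _ :=
  𝔤 →ₗ⁅ℝ⁆ SmoothVF E M

namespace LieAlgAction

/-- `y` is the endpoint of a path `γ : [0, 1] → M` from `x` along the action: its velocity is
`γ'(t) = #(ξ(t))(γ(t))` for some continuous path `ξ : [0, 1] → 𝔤` (continuity in the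
finite-dimensional space `𝔤` is tested by linear functionals). For constant `ξ` these are the
integral curves of the vector fields generated by `𝔤`. -/
def Reaches (A : LieAlgAction 𝔤 E M) (x y : M) : Prop :=
  ∃ (γ : ℝ → M) (ξ : ℝ → 𝔤), γ 0 = x ∧ γ 1 = y ∧
    (∀ φ : Module.Dual ℝ 𝔤, ContinuousOn (fun t => φ (ξ t)) (Icc 0 1)) ∧
    ∀ t ∈ Icc (0 : ℝ) 1, HasMFDerivWithinAt 𝓘(ℝ, ℝ) 𝓘(ℝ, E) γ (Icc 0 1) t
      ((1 : ℝ →L[ℝ] ℝ).smulRight (A (ξ t) (γ t)))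

/-- The orbit of the action through `m`. -/
def orbit (A : LieAlgAction 𝔤 E M) (m : M) : Set M := {y | Relation.EqvGen A.Reaches m y}

/-- The tangent space at `m` of the orbit through `m`: all values at `m` of the vector fields
generated by the action. -/
def orbitTangent (A : LieAlgAction 𝔤 E M) (m : M) : Submodule ℝ (TangentSpace 𝓘(ℝ, E) m) where
  carrier := {v | ∃ ξ : 𝔤, A ξ m = v}
  add_mem' := by
    rintro _ _ ⟨ξ, rfl⟩ ⟨η, rfl⟩
    exact ⟨ξ + η, by rw [map_add]; rfl⟩
  zero_mem' := ⟨0, by rw [map_zero]; rfl⟩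
  smul_mem' := by
    rintro c _ ⟨ξ, rfl⟩
    exact ⟨c • ξ, by rw [map_smul]; rfl⟩

/-- The action is free: all orbits have the dimension of the Lie algebra. -/
def IsFree (A : LieAlgAction 𝔤 E M) : Prop :=
  ∀ m, Module.finrank ℝ (A.orbitTangent m) = Module.finrank ℝ 𝔤

/-- The leaves of the foliation are the orbits of the action, as immersed submanifolds: leaf and
orbit through each point have the same points and the same tangent spaces. -/
def OrbitsAreLeaves (A : LieAlgAction 𝔤 E M) (F : RegularFoliation E M) : Prop :=
  ∀ m, A.orbit m = F.leaf m ∧ A.orbitTangent m = F.tangent m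

end LieAlgAction

end Actions

end

/-! From an action to a connection: when the action is free, evaluation of the Lie algebra at a
point is an isomorphism onto the orbit's tangent space, so a basis gives a global frame `X i` of `D`
whose brackets have constant coefficients. Declare this frame parallel, that is, put `∇_V (∑ f i • X
i) = ∑ df i (V) • X i`. Flatness of `∇` is the identity `[V, W] f = V W f - W V f` for the
coefficients. The curvature of `∇̄` is linear over smooth functions in both sections of `D`, so it
only has to be tested on the frame; there `∇̄_X` is the bracket with `X`, brackets of frame fields
are again parallel, and the curvature vanishes by the Jacobi identity. This is
`exists_flat_connection_of_frame`; of the action it uses only freeness and the equality of tangent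
spaces.

From a connection to an action: the Lie algebra is the space of global parallel sections of `D`. For
parallel `X`, `Y` the curvature of `∇̄` equals `-∇_V [X, Y]`, so flatness of `∇̄` says exactly that
these sections are closed under the bracket (`parallelSections`). It remains to see that evaluation
at each point is a bijection onto `D m`.

Injectivity is uniqueness for a linear differential equation along rays in a chart, propagated by
connectedness (`eventually_eq_zero_of_parallel`, `eq_zero_of_parallel`). Surjectivity starts with
local parallel frames: in a foliated chart `∇` is given by a matrix-valued form `A` satisfying the
structure equation, and one has to solve `dG = -A G` (`exists_parallel_of_flat`,
`exists_local_parallel`). The changes between such frames are locally constant, so they define a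
bundle with discrete fibre, a covering, which has sections through any point because `M` is simply
connected (`exists_section_of_locally_constant_cocycle`, `exists_global_parallel`).

Finally, fields which span `D` everywhere have the leaves as orbits (`orbit_eq_leaf`). Controlled
paths are locally contained in plaques, and nearby points of a slice are joined by a straight
segment whose velocity has continuous coefficients in the frame. -/

noncomputable section

set_option linter.unusedSectionVars false

/-! ### Integration of flat matrix-valued connection forms on a vector space -/

section FlatForms

variable {E : Type*} [NormedAddCommGroup E] [NormedSpace ℝ E]
  {R : Type*} [NormedRing R] [NormedAlgebra ℝ R]

/-- Solutions on `[0, 1]` of a linear differential equation with small coefficients. -/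
theorem exists_linear_ode_solution [CompleteSpace R] {a : ℝ → R} (ha : ContinuousOn a (Icc 0 1))
    (hb : ∀ t ∈ Icc (0 : ℝ) 1, ‖a t‖ ≤ 1 / 2) :
    ∃ u : ℝ → R, u 0 = 1 ∧ ∀ t ∈ Icc (0 : ℝ) 1,
      HasDerivWithinAt u (-(a t * u t)) (Icc 0 1) t := by
  -- In the ball of radius `‖1‖` around `1` one has `‖x‖ ≤ 2 * ‖1‖`, so the bound `1 / 2` on the
  -- coefficient limits the speed to `‖1‖`. The solution therefore stays in the ball for the whole
  -- unit of time. The norm of `1` need not be one in `R`.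
  have hpl : IsPicardLindelof (fun t u => -(a t * u)) (⟨0, by simp⟩ : Icc (0 : ℝ) 1) (1 : R)
      ‖(1 : R)‖₊ 0 ‖(1 : R)‖₊ 1 := by
    constructor
    · intro t ht
      refine LipschitzOnWith.of_dist_le_mul fun x _ y _ => ?_
      rw [dist_neg_neg, dist_eq_norm, ← mul_sub, dist_eq_norm]
      refine (norm_mul_le _ _).trans ?_
      have := hb t ht
      gcongr
      simp only [NNReal.coe_one]
      linarith
    · intro x _
      exact (ha.mul continuousOn_const).neg
    · intro t ht x hx
      rw [norm_neg]
      refine (norm_mul_le _ _).trans ?_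
      have h1 : ‖x‖ ≤ 2 * ‖(1 : R)‖ := by
        have h2 : ‖x - 1‖ ≤ ‖(1 : R)‖ := by simpa [dist_eq_norm] using hx
        have h3 := norm_add_le (x - 1) 1
        rw [sub_add_cancel] at h3
        linarith
      calc ‖a t‖ * ‖x‖ ≤ 1 / 2 * (2 * ‖(1 : R)‖) := by
            gcongr
            exact hb t ht
        _ = _ := by rw [coe_nnnorm]; ring
    · simp
  obtain ⟨u, hu0, hu⟩ := hpl.exists_eq_forall_mem_Icc_hasDerivWithinAt₀
  exact ⟨u, hu0, hu⟩

/-- The error made by replacing the solution along a ray by its first order variation. -/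
theorem flat_variation_identity {a a' : E →L[ℝ] R} {D : E →L[ℝ] E →L[ℝ] R} {y h : E} (t : ℝ) (u : R)
    (hflat : D h y - D y h + (a h * a y - a y * a h) = 0) :
    (-(a y * u) - (a h * u + t • (D y h * u + a h * -(a y * u))))
        + a' (y + h) * (u - t • (a h * u)) =
      (t • D h h + (a' - a - t • D h) (y + h) - t • (a h * a h)
        - t • ((a' - a) (y + h) * a h)) * u := by
  -- Here `a` and `a'` are the values of the form at time `t` on the rays in the directions `y` and
  -- `y + h`. Differentiating the variation along the ray produces `D y h`, while the change of the
  -- coefficient produces `D h y`; flatness lets these cancel together with the commutator, leaving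
  -- only terms of second order in `h`.
  have h1 : D h y * u - D y h * u + (a h * (a y * u) - a y * (a h * u)) = 0 := by
    have := congrArg (· * u) hflat
    simpa [add_mul, sub_mul, mul_assoc] using this
  simp only [map_add, sub_apply, smul_apply, add_mul,
    sub_mul, mul_sub, smul_mul_assoc, mul_smul_comm, mul_assoc, mul_neg]
  linear_combination (norm := module) t • h1

/-- **Flat connection forms are locally gauge-trivial.** -/
theorem exists_parallel_of_flat [CompleteSpace R] {A : E → E →L[ℝ] R} {z : E}
    (hA : ContDiffAt ℝ 2 A z)
    (hflat : ∀ᶠ x in 𝓝 z, ∀ v w, fderiv ℝ A x v w - fderiv ℝ A x w v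
      + (A x v * A x w - A x w * A x v) = 0) :
    ∃ G : E → R, G z = 1 ∧ ∀ᶠ x in 𝓝 z,
      HasFDerivAt G (-(((ContinuousLinearMap.mul ℝ R).flip (G x)).comp (A x))) x := by
  obtain ⟨K, s, hs, hK⟩ : ∃ K, ∃ s ∈ 𝓝 z, LipschitzOnWith K (fderiv ℝ A) s :=
    (hA.fderiv_right (m := 1) (by norm_num)).exists_lipschitzOnWith
  have hd : ∀ᶠ x in 𝓝 z, DifferentiableAt ℝ A x :=
    (hA.eventually (by simp)).mono fun x hx => hx.differentiableAt (by simp)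
  have hbA : ∀ᶠ x in 𝓝 z, ‖A x‖ < ‖A z‖ + 1 :=
    hA.continuousAt.norm.eventually_lt continuousAt_const (by simp)
  have hbD : ∀ᶠ x in 𝓝 z, ‖fderiv ℝ A x‖ < ‖fderiv ℝ A z‖ + 1 :=
    (hA.fderiv_right (m := 1) (by norm_num)).continuousAt.norm.eventually_lt
      continuousAt_const (by simp)
  obtain ⟨ρ, hρ, hball⟩ := Metric.eventually_nhds_iff_ball.1
    (((hd.and hbA).and (hbD.and hflat)).and (eventually_mem_set.2 hs))
  obtain ⟨C, hC0, hCA, hCD⟩ : ∃ C : ℝ, 0 < C ∧ (∀ x ∈ Metric.ball z ρ, ‖A x‖ ≤ C) ∧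
      ∀ x ∈ Metric.ball z ρ, ‖fderiv ℝ A x‖ ≤ C := by
    refine ⟨‖A z‖ + 1 + (‖fderiv ℝ A z‖ + 1), by positivity, fun x hx => ?_, fun x hx => ?_⟩
    · have := (hball x hx).1.1.2
      have := norm_nonneg (fderiv ℝ A z)
      linarith
    · have := (hball x hx).1.2.1
      have := norm_nonneg (A z)
      linarith
  -- The bound by `ρ` keeps the rays in the good ball, `C * δ ≤ 1 / 2` makes the ray equation
  -- accessible to `exists_linear_ode_solution`, and `δ ≤ 1` removes the factor `‖y + h‖` from the
  -- error estimates.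
  obtain ⟨δ, hδ0, hδρ, hδ1, hδC⟩ : ∃ δ : ℝ, 0 < δ ∧ δ ≤ ρ ∧ δ ≤ 1 ∧ C * δ ≤ 1 / 2 := by
    refine ⟨min (min ρ 1) (1 / (2 * C)), by positivity, (min_le_left _ _).trans (min_le_left _ _),
      (min_le_left _ _).trans (min_le_right _ _), ?_⟩
    calc C * min (min ρ 1) (1 / (2 * C)) ≤ C * (1 / (2 * C)) := by
          gcongr
          exact min_le_right _ _
      _ = 1 / 2 := by field_simp
  have hseg : ∀ y : E, ‖y‖ < δ → ∀ t ∈ Icc (0 : ℝ) 1, z + t • y ∈ Metric.ball z ρ := by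
    intro y hy t ht
    rw [mem_ball_iff_norm, add_sub_cancel_left, norm_smul, Real.norm_of_nonneg ht.1]
    calc t * ‖y‖ ≤ 1 * ‖y‖ := by gcongr; exact ht.2
      _ < ρ := by linarith
  have hAd : ∀ x ∈ Metric.ball z ρ, HasFDerivAt A (fderiv ℝ A x) x :=
    fun x hx => (hball x hx).1.1.1.hasFDerivAt
  have hcurve : ∀ y v : E, ‖y‖ < δ → ∀ t ∈ Icc (0 : ℝ) 1,
      HasDerivWithinAt (fun t : ℝ => A (z + t • y) v) (fderiv ℝ A (z + t • y) y v) (Icc 0 1) t := by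
    intro y v hy t ht
    have h1 : HasDerivWithinAt (fun t : ℝ => z + t • y) y (Icc 0 1) t := by
      simpa using (((hasDerivAt_id t).smul_const y).const_add z).hasDerivWithinAt
    exact (HasFDerivAt.comp_hasDerivWithinAt t (hAd _ (hseg y hy t ht)) h1).clm_apply
      (hasDerivWithinAt_const t _ v) |>.congr_deriv (by simp)
  have hsmall : ∀ y : E, ‖y‖ < δ → ∀ t ∈ Icc (0 : ℝ) 1, ‖A (z + t • y) y‖ ≤ 1 / 2 := by
    intro y hy t ht
    calc ‖A (z + t • y) y‖ ≤ ‖A (z + t • y)‖ * ‖y‖ := ContinuousLinearMap.le_opNorm _ _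
      _ ≤ C * δ := by
        gcongr
        exact hCA _ (hseg y hy t ht)
      _ ≤ 1 / 2 := hδC
  have hex : ∀ y : E, ∃ u : ℝ → R, ‖y‖ < δ → u 0 = 1 ∧ ∀ t ∈ Icc (0 : ℝ) 1,
      HasDerivWithinAt u (-(A (z + t • y) y * u t)) (Icc 0 1) t := by
    intro y
    by_cases hy : ‖y‖ < δ
    · obtain ⟨u, hu⟩ := exists_linear_ode_solution (a := fun t => A (z + t • y) y)
        (fun t ht => (hcurve y y hy t ht).continuousWithinAt) (hsmall y hy)
      exact ⟨u, fun _ => hu⟩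
    · exact ⟨0, fun h => absurd h hy⟩
  choose u hu using hex
  have key : ∀ y : E, ‖y‖ < δ → ∃ B : ℝ, ∀ h : E, ‖y + h‖ < δ →
      ‖u (y + h) 1 - (u y 1 - A (z + y) h * u y 1)‖ ≤ B * ‖h‖ ^ 2 := by
    intro y hy
    obtain ⟨hu0, hud⟩ := hu y hy
    have hcont : ContinuousOn (u y) (Icc 0 1) := fun t ht => (hud t ht).continuousWithinAt
    obtain ⟨B, hB⟩ := isCompact_Icc.exists_bound_of_continuousOn hcont
    have hB0 : 0 ≤ B := (norm_nonneg _).trans (hB 0 (by simp))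
    set Q : ℝ := (C + K + C * C + C * C) * B with hQ
    have hconv := convex_ball z ρ
    -- The Gronwall bound at time `1` for initial error `0`, Lipschitz constant `1 / 2` and defect
    -- `Q * ‖h‖ ^ 2`; the factor `2` is the inverse of `1 / 2`.
    refine ⟨Q * (Real.exp (1 / 2) - 1) * 2, fun h hh => ?_⟩
    obtain ⟨hv0, hvd⟩ := hu (y + h) hh
    -- If `u y t` is to be `G (z + t • y)` with `dG = -A G`, then replacing `y` by `y + h` changes
    -- it to first order by `-t • A h u`. The function `w` is this prediction; it is compared with
    -- the true solution `u (y + h)`.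
    set w : ℝ → R := fun t => u y t - t • (A (z + t • y) h * u y t) with hw
    have hwd : ∀ t ∈ Icc (0 : ℝ) 1, HasDerivWithinAt w
        (-(A (z + t • y) y * u y t) - (A (z + t • y) h * u y t + t • (fderiv ℝ A (z + t • y) y h
          * u y t + A (z + t • y) h * -(A (z + t • y) y * u y t)))) (Icc 0 1) t := by
      intro t ht
      have h1 := (hcurve y h hy t ht).mul (hud t ht)
      have h2 := (hasDerivWithinAt_id t (Icc (0 : ℝ) 1)).smul h1
      refine ((hud t ht).sub h2).congr_deriv ?_
      simp only [id, one_smul]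
      abel
    have hIci : ∀ {f : ℝ → R} {f' : R} {t : ℝ}, t ∈ Ico (0 : ℝ) 1 →
        HasDerivWithinAt f f' (Icc 0 1) t → HasDerivWithinAt f f' (Ici t) t := by
      intro f f' t ht hf
      have h1 : HasDerivWithinAt f f' (Icc t 1) t := hf.mono (Icc_subset_Icc_left ht.1)
      exact h1.mono_of_mem_nhdsWithin (Icc_mem_nhdsGE ht.2)
    have hg := dist_le_of_approx_trajectories_ODE_of_mem (a := 0) (b := 1) (δ := 0)
      (K := 1 / 2) (εf := 0) (εg := Q * ‖h‖ ^ 2)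
      (v := fun t x => -(A (z + t • (y + h)) (y + h) * x)) (s := fun _ => univ)
      (f := u (y + h)) (g := w) (f' := fun t => -(A (z + t • (y + h)) (y + h) * u (y + h) t))
      (fun t ht => ?_) (fun t ht => (hvd t ht).continuousWithinAt)
      (fun t ht => hIci ht (hvd t (Ico_subset_Icc_self ht))) (by simp) (fun _ _ => trivial)
      (fun t ht => (hwd t ht).continuousWithinAt)
      (fun t ht => hIci ht (hwd t (Ico_subset_Icc_self ht))) (fun t ht => ?_)
      (fun _ _ => trivial) (by simp [hw, hu0, hv0]) 1 (by simp)
    · rw [dist_eq_norm] at hg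
      simp only [hw, one_smul] at hg
      refine hg.trans (le_of_eq ?_)
      have : ((1 / 2 : NNReal) : ℝ) = 1 / 2 := by simp
      rw [this, gronwallBound_of_K_ne_0 (by norm_num)]
      norm_num
      ring
    · refine LipschitzOnWith.of_dist_le_mul fun x _ x' _ => ?_
      rw [dist_neg_neg, dist_eq_norm, ← mul_sub, dist_eq_norm]
      refine (norm_mul_le _ _).trans ?_
      gcongr
      exact hsmall _ hh t (Ico_subset_Icc_self ht)
    · have ht' := Ico_subset_Icc_self ht
      have hx := hseg y hy t ht'
      have hx' := hseg (y + h) hh t ht'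
      have hdiff : (z + t • (y + h)) - (z + t • y) = t • h := by module
      have hnt : ‖t • h‖ ≤ ‖h‖ := by
        rw [norm_smul, Real.norm_of_nonneg ht.1]
        exact mul_le_of_le_one_left (norm_nonneg _) ht.2.le
      rw [dist_eq_norm, sub_neg_eq_add,
        flat_variation_identity t (u y t) ((hball _ hx).1.2.2 h y)]
      have e1 : ‖A (z + t • (y + h)) - A (z + t • y)‖ ≤ C * ‖h‖ := by
        refine (hconv.norm_image_sub_le_of_norm_hasFDerivWithin_le
          (fun x hx => (hAd x hx).hasFDerivWithinAt) hCD hx hx').trans ?_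
        rw [hdiff]
        gcongr
      -- The derivative of `A` is Lipschitz because `A` is of class `C²`, which makes the Taylor
      -- remainder quadratic.
      have e2 : ‖A (z + t • (y + h)) - A (z + t • y) - t • fderiv ℝ A (z + t • y) h‖
          ≤ K * ‖h‖ * ‖h‖ := by
        have hsub : segment ℝ (z + t • y) (z + t • (y + h)) ⊆ Metric.ball z ρ :=
          hconv.segment_subset hx hx'
        have := (convex_segment (z + t • y) (z + t • (y + h))).norm_image_sub_le_of_norm_hasFDerivWithin_le'
          (f := A) (φ := fderiv ℝ A (z + t • y)) (C := K * ‖h‖)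
          (fun x hx => (hAd x (hsub hx)).hasFDerivWithinAt) (fun x hx => ?_)
          (left_mem_segment _ _ _) (right_mem_segment _ _ _)
        · rw [hdiff, map_smul] at this
          refine this.trans ?_
          gcongr
        · rw [← dist_eq_norm]
          refine (hK.dist_le_mul x (hball x (hsub hx)).2 _ (hball _ (by assumption)).2).trans ?_
          gcongr
          obtain ⟨b, ⟨hb0, hb1⟩, rfl⟩ := (segment_eq_image' ℝ (z + t • y) (z + t • (y + h))) ▸ hx
          rw [hdiff, dist_eq_norm, add_sub_cancel_left, norm_smul, Real.norm_of_nonneg hb0]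
          exact (mul_le_of_le_one_left (norm_nonneg _) hb1).trans hnt
      have e3 : ‖y + h‖ ≤ 1 := by linarith
      have et : ‖t‖ ≤ 1 := by rw [Real.norm_of_nonneg ht.1]; exact ht.2.le
      have f1 : ‖t • fderiv ℝ A (z + t • y) h h‖ ≤ C * ‖h‖ ^ 2 := by
        rw [norm_smul]
        calc _ ≤ 1 * (C * ‖h‖ * ‖h‖) := by
              gcongr
              exact (ContinuousLinearMap.le_opNorm₂ _ _ _).trans (by gcongr; exact hCD _ hx)
          _ = _ := by ring
      have f2 : ‖(A (z + t • (y + h)) - A (z + t • y) - t • fderiv ℝ A (z + t • y) h) (y + h)‖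
          ≤ K * ‖h‖ ^ 2 := by
        refine (ContinuousLinearMap.le_opNorm _ _).trans ?_
        calc _ ≤ K * ‖h‖ * ‖h‖ * 1 := by gcongr
          _ = _ := by ring
      have f0 : ‖A (z + t • y) h‖ ≤ C * ‖h‖ :=
        (ContinuousLinearMap.le_opNorm _ _).trans (by gcongr; exact hCA _ hx)
      have f3 : ‖t • (A (z + t • y) h * A (z + t • y) h)‖ ≤ C * C * ‖h‖ ^ 2 := by
        rw [norm_smul]
        calc _ ≤ 1 * ((C * ‖h‖) * (C * ‖h‖)) := by
              gcongr
              exact (norm_mul_le _ _).trans (by gcongr)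
          _ = _ := by ring
      have f4 : ‖t • ((A (z + t • (y + h)) - A (z + t • y)) (y + h) * A (z + t • y) h)‖
          ≤ C * C * ‖h‖ ^ 2 := by
        rw [norm_smul]
        calc _ ≤ 1 * ((C * ‖h‖ * 1) * (C * ‖h‖)) := by
              gcongr
              refine (norm_mul_le _ _).trans ?_
              gcongr
              exact (ContinuousLinearMap.le_opNorm _ _).trans (by gcongr)
          _ = _ := by ring
      refine (norm_mul_le _ _).trans ?_
      calc _ ≤ (C * ‖h‖ ^ 2 + K * ‖h‖ ^ 2 + C * C * ‖h‖ ^ 2 + C * C * ‖h‖ ^ 2) * B := by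
            gcongr
            · exact (norm_sub_le _ _).trans (add_le_add ((norm_sub_le _ _).trans
                (add_le_add ((norm_add_le _ _).trans (add_le_add f1 f2)) f3)) f4)
            · exact hB t ht'
        _ = _ := by rw [hQ]; ring
  refine ⟨fun x => u (x - z) 1, ?_, ?_⟩
  · obtain ⟨h0, hd0⟩ := hu 0 (by simpa using hδ0)
    simp only [sub_self]
    have hc : ∀ t ∈ Icc (0 : ℝ) 1, u 0 t = u 0 0 :=
      constant_of_has_deriv_right_zero (fun t ht => (hd0 t ht).continuousWithinAt)
        fun t ht => by
          have := hd0 t (Ico_subset_Icc_self ht)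
          simp only [map_zero, zero_mul, neg_zero] at this
          exact (this.mono (Icc_subset_Icc_left ht.1)).mono_of_mem_nhdsWithin (Icc_mem_nhdsGE ht.2)
    rw [hc 1 (by simp), h0]
  · filter_upwards [Metric.ball_mem_nhds z hδ0] with x hx
    rw [mem_ball_iff_norm] at hx
    obtain ⟨B, hB⟩ := key (x - z) hx
    set L := -(((ContinuousLinearMap.mul ℝ R).flip (u (x - z) 1)).comp (A x)) with hL
    have hbig : (fun x' => u (x' - z) 1 - u (x - z) 1 - L (x' - x)) =O[𝓝 x]
        fun x' => ‖x' - x‖ ^ 2 := by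
      refine Asymptotics.IsBigO.of_bound B ?_
      have : ∀ᶠ x' in 𝓝 x, ‖x' - z‖ < δ :=
        (continuous_id.sub continuous_const).norm.continuousAt.eventually_lt continuousAt_const hx
      filter_upwards [this] with x' hx'
      have := hB (x' - x) (by rwa [show x - z + (x' - x) = x' - z by abel])
      rw [show x - z + (x' - x) = x' - z by abel, show z + (x - z) = x by abel] at this
      rw [norm_pow, norm_norm]
      refine le_of_eq_of_le ?_ this
      congr 1
      simp only [hL, neg_apply, ContinuousLinearMap.comp_apply,
        ContinuousLinearMap.flip_apply, ContinuousLinearMap.mul_apply']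
      abel
    have h0 := hbig.hasFDerivAt (𝕜 := ℝ) (by norm_num)
    have h1 : HasFDerivAt (fun x' => L (x' - x) + u (x - z) 1) L x := by
      simpa using (L.hasFDerivAt.comp x ((hasFDerivAt_id x).sub_const x)).add_const (u (x - z) 1)
    have h2 := h0.add h1
    rw [zero_add] at h2
    refine h2.congr_of_eventuallyEq (Eventually.of_forall fun x' => ?_)
    simp only [Pi.add_apply]
    abel

end FlatForms

/-! ### Vector fields, derivatives and brackets in a chart; cut-off coordinate fields -/

section ChartCalculus

variable {E : Type*} [NormedAddCommGroup E] [NormedSpace ℝ E]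
  {M : Type*} [TopologicalSpace M] [ChartedSpace E M] [IsManifold 𝓘(ℝ, E) ∞ M]

/-- The coordinate representation of a vector field in the chart `e`. -/
def chartRep (e : OpenPartialHomeomorph M E) (X : SmoothVF E M) (x : E) : E :=
  mfderiv 𝓘(ℝ, E) 𝓘(ℝ, E) e (e.symm x) (X (e.symm x))

theorem mdifferentiable_of_mem_maximalAtlas {e : OpenPartialHomeomorph M E}
    (he : e ∈ IsManifold.maximalAtlas 𝓘(ℝ, E) ∞ M) : e.MDifferentiable 𝓘(ℝ, E) 𝓘(ℝ, E) :=
  ⟨(contMDiffOn_of_mem_maximalAtlas he).mdifferentiableOn (by simp),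
    (contMDiffOn_symm_of_mem_maximalAtlas he).mdifferentiableOn (by simp)⟩

theorem chartRep_add (e : OpenPartialHomeomorph M E) (X Y : SmoothVF E M) (x : E) :
    chartRep e (X + Y) x = chartRep e X x + chartRep e Y x :=
  map_add (mfderiv 𝓘(ℝ, E) 𝓘(ℝ, E) e (e.symm x)) _ _

theorem chartRep_smul (e : OpenPartialHomeomorph M E) (c : ℝ) (X : SmoothVF E M) (x : E) :
    chartRep e (c • X) x = c • chartRep e X x :=
  map_smul (mfderiv 𝓘(ℝ, E) 𝓘(ℝ, E) e (e.symm x)) _ _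

theorem chartRep_smulFn (e : OpenPartialHomeomorph M E) (f : SmoothFn E M) (X : SmoothVF E M)
    (x : E) : chartRep e (f • X) x = f (e.symm x) • chartRep e X x :=
  map_smul (mfderiv 𝓘(ℝ, E) 𝓘(ℝ, E) e (e.symm x)) _ _

theorem chartRep_zero (e : OpenPartialHomeomorph M E) (x : E) :
    chartRep e (0 : SmoothVF E M) x = 0 :=
  map_zero (mfderiv 𝓘(ℝ, E) 𝓘(ℝ, E) e (e.symm x))

theorem chartRep_sum (e : OpenPartialHomeomorph M E) {ι : Type*} (s : Finset ι)
    (X : ι → SmoothVF E M) (x : E) :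
    chartRep e (∑ i ∈ s, X i) x = ∑ i ∈ s, chartRep e (X i) x := by
  classical
  induction s using Finset.induction_on with
  | empty => simpa using chartRep_zero e x
  | insert i s hi ih => rw [Finset.sum_insert hi, Finset.sum_insert hi, chartRep_add, ih]

variable {e : OpenPartialHomeomorph M E}

theorem chartRep_apply_self {m : M} (hm : m ∈ e.source) (X : SmoothVF E M) :
    chartRep e X (e m) = mfderiv 𝓘(ℝ, E) 𝓘(ℝ, E) e m (X m) := by
  unfold chartRep
  rw [e.left_inv hm]

theorem mfderiv_chart_injective (he : e ∈ IsManifold.maximalAtlas 𝓘(ℝ, E) ∞ M) {m : M}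
    (hm : m ∈ e.source) : Function.Injective (mfderiv 𝓘(ℝ, E) 𝓘(ℝ, E) e m) :=
  (mdifferentiable_of_mem_maximalAtlas he).mfderiv_injective hm

theorem chartRep_injective (he : e ∈ IsManifold.maximalAtlas 𝓘(ℝ, E) ∞ M) {m : M}
    (hm : m ∈ e.source) {X Y : SmoothVF E M} (h : chartRep e X (e m) = chartRep e Y (e m)) :
    X m = Y m := by
  rw [chartRep_apply_self hm, chartRep_apply_self hm] at h
  exact mfderiv_chart_injective he hm h

/-- A bump function equal to one near `m` and supported in a given neighbourhood. -/
theorem exists_smooth_bump [FiniteDimensional ℝ E] [T2Space M] {m : M} {U : Set M} (hU : U ∈ 𝓝 m) :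
    ∃ ψ : SmoothFn E M, tsupport ψ ⊆ U ∧ ∀ᶠ x in 𝓝 m, ψ x = 1 := by
  obtain ⟨f, -, hf⟩ := (SmoothBumpFunction.nhds_basis_tsupport (I := 𝓘(ℝ, E)) m).mem_iff.1 hU
  exact ⟨⟨f, f.contMDiff⟩, hf, f.eventuallyEq_one⟩

/-- The product of a bump function and a locally defined smooth function. -/
def SmoothFn.cutoff (ψ : SmoothFn E M) {U : Set M} (hU : IsOpen U) (hψ : tsupport ψ ⊆ U) (h : M → ℝ)
    (hh : ContMDiffOn 𝓘(ℝ, E) 𝓘(ℝ, ℝ) ∞ h U) : SmoothFn E M :=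
  ⟨fun m => ψ m * h m, by
    refine contMDiff_of_tsupport fun m hm => ?_
    have hmU : m ∈ U := hψ (tsupport_mul_subset_left hm)
    exact (ψ.contMDiff m).mul ((hh m hmU).contMDiffAt (hU.mem_nhds hmU))⟩

theorem SmoothFn.cutoff_apply (ψ : SmoothFn E M) {U : Set M} (hU : IsOpen U) (hψ : tsupport ψ ⊆ U)
    (h : M → ℝ) (hh : ContMDiffOn 𝓘(ℝ, E) 𝓘(ℝ, ℝ) ∞ h U) (m : M) :
    ψ.cutoff hU hψ h hh m = ψ m * h m := rfl

theorem contDiffOn_comp_chart_symm (he : e ∈ IsManifold.maximalAtlas 𝓘(ℝ, E) ∞ M)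
    (f : SmoothFn E M) : ContDiffOn ℝ ∞ (f ∘ e.symm) e.target :=
  (f.contMDiff.comp_contMDiffOn (contMDiffOn_symm_of_mem_maximalAtlas he)).contDiffOn

theorem contMDiffOn_comp_chart (he : e ∈ IsManifold.maximalAtlas 𝓘(ℝ, E) ∞ M) {F : Type*}
    [NormedAddCommGroup F] [NormedSpace ℝ F] {g : E → F} {B : Set E} (hg : ContDiffOn ℝ ∞ g B) :
    ContMDiffOn 𝓘(ℝ, E) 𝓘(ℝ, F) ∞ (g ∘ e) (e.source ∩ e ⁻¹' B) :=
  hg.contMDiffOn.comp ((contMDiffOn_of_mem_maximalAtlas he).mono inter_subset_left)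
    inter_subset_right

theorem SmoothFn.dirDeriv_eq_fderiv (he : e ∈ IsManifold.maximalAtlas 𝓘(ℝ, E) ∞ M)
    (f : SmoothFn E M) (V : SmoothVF E M) {x : E} (hx : x ∈ e.target) :
    f.dirDeriv V (e.symm x) = fderiv ℝ (f ∘ e.symm) x (chartRep e V x) := by
  have hd := mdifferentiable_of_mem_maximalAtlas he
  have hf : MDifferentiableAt 𝓘(ℝ, E) 𝓘(ℝ, ℝ) f (e.symm x) :=
    (f.contMDiff _).mdifferentiableAt (by simp)
  have h1 := mfderiv_comp x hf (hd.mdifferentiableAt_symm hx)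
  rw [mfderiv_eq_fderiv] at h1
  rw [h1]
  have h2 := hd.symm_comp_deriv (e.map_target hx)
  rw [e.right_inv hx] at h2
  exact (congrArg (fun L : E →L[ℝ] E => (mfderiv 𝓘(ℝ, E) 𝓘(ℝ, ℝ) f (e.symm x) : E →L[ℝ] ℝ)
    (L (V (e.symm x)))) h2).symm

variable [FiniteDimensional ℝ E]

/-- The derivatives of a chart and of its inverse are mutually inverse. This gives `chartRep` access
to the results on smoothness and brackets of pulled back fields. -/
theorem mpullback_chart_symm (he : e ∈ IsManifold.maximalAtlas 𝓘(ℝ, E) ∞ M) (X : SmoothVF E M)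
    {x : E} (hx : x ∈ e.target) :
    mpullback 𝓘(ℝ, E) 𝓘(ℝ, E) e.symm X x = chartRep e X x := by
  have hd := mdifferentiable_of_mem_maximalAtlas he
  rw [mpullback_apply]
  refine congrArg (fun L : _ →L[ℝ] E => L (X (e.symm x))) (ContinuousLinearMap.inverse_eq ?_ ?_)
  · have := hd.symm_comp_deriv (e.map_target hx)
    rwa [e.right_inv hx] at this
  · exact hd.comp_symm_deriv hx

theorem contDiffOn_chartRep (he : e ∈ IsManifold.maximalAtlas 𝓘(ℝ, E) ∞ M) (X : SmoothVF E M) :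
    ContDiffOn ℝ ∞ (chartRep e X) e.target := by
  have := FiniteDimensional.complete ℝ E
  have hd := mdifferentiable_of_mem_maximalAtlas he
  have h1 : ContMDiffOn 𝓘(ℝ, E) 𝓘(ℝ, E).tangent ∞
      (fun x => (⟨x, mpullback 𝓘(ℝ, E) 𝓘(ℝ, E) e.symm X x⟩ : TangentBundle 𝓘(ℝ, E) E))
      e.target := fun x hx =>
    (ContMDiffAt.mpullback_vectorField_preimage (X.contMDiff _)
      (contMDiffAt_symm_of_mem_maximalAtlas he hx)
      ⟨hd.symm.mfderiv hx, rfl⟩ (by simp)).contMDiffWithinAt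
  rw [contMDiffOn_vectorSpace_iff_contDiffOn] at h1
  exact h1.congr fun x hx => (mpullback_chart_symm he X hx).symm

theorem contDiffAt_chartRep (he : e ∈ IsManifold.maximalAtlas 𝓘(ℝ, E) ∞ M) (X : SmoothVF E M)
    {x : E} (hx : x ∈ e.target) : ContDiffAt ℝ ∞ (chartRep e X) x :=
  (contDiffOn_chartRep he X).contDiffAt (e.open_target.mem_nhds hx)

theorem differentiableAt_chartRep (he : e ∈ IsManifold.maximalAtlas 𝓘(ℝ, E) ∞ M)
    (X : SmoothVF E M) {x : E} (hx : x ∈ e.target) : DifferentiableAt ℝ (chartRep e X) x :=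
  (contDiffAt_chartRep he X hx).differentiableAt (by simp)

/-- The bracket commutes with the pullback by `e.symm`, and on the model space it is the usual
bracket of vector-valued maps. Only the germs at `x` matter, so the pullbacks may be replaced by
`chartRep`. -/
theorem chartRep_bracket (he : e ∈ IsManifold.maximalAtlas 𝓘(ℝ, E) ∞ M) (X Y : SmoothVF E M)
    {x : E} (hx : x ∈ e.target) :
    chartRep e ⁅X, Y⁆ x = fderiv ℝ (chartRep e Y) x (chartRep e X x)
      - fderiv ℝ (chartRep e X) x (chartRep e Y x) := by
  have := FiniteDimensional.complete ℝ E
  have : IsManifold 𝓘(ℝ, E) (minSmoothness ℝ 2) M := by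
    rw [minSmoothness_of_isRCLikeNormedField]
    exact IsManifold.of_le (n := ∞) (by exact two_le_smooth)
  have key := mpullback_mlieBracket (n := ∞) (V := X) (W := Y) (f := e.symm) (x₀ := x)
    (I := 𝓘(ℝ, E)) (I' := 𝓘(ℝ, E)) (X.mdifferentiableAt _) (Y.mdifferentiableAt _)
    (contMDiffAt_symm_of_mem_maximalAtlas he hx)
    (by rw [minSmoothness_of_isRCLikeNormedField]; exact two_le_smooth)
  have h1 : mpullback 𝓘(ℝ, E) 𝓘(ℝ, E) e.symm (mlieBracket 𝓘(ℝ, E) X Y) x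
      = chartRep e ⁅X, Y⁆ x := mpullback_chart_symm he ⁅X, Y⁆ hx
  have h2 (V W : Π x : E, TangentSpace 𝓘(ℝ, E) x) :
      mlieBracket 𝓘(ℝ, E) V W x = lieBracket (E := E) ℝ V W x :=
    (congrFun mlieBracketWithin_univ _).symm.trans
      ((congrFun mlieBracketWithin_eq_lieBracketWithin _).trans
        (congrFun (lieBracketWithin_univ (E := E)) _))
  have h3 (W : SmoothVF E M) : (mpullback 𝓘(ℝ, E) 𝓘(ℝ, E) e.symm W : E → E) =ᶠ[𝓝 x]
      chartRep e W := by
    filter_upwards [e.open_target.mem_nhds hx] with w hw using mpullback_chart_symm he W hw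
  rw [h1] at key
  refine key.trans ((h2 _ _).trans ?_)
  have h4 := Filter.EventuallyEq.lieBracket_vectorField_eq (𝕜 := ℝ) (h3 X) (h3 Y)
  exact h4

/-- The derivative `df(V)` as a smooth function. -/
def SmoothFn.lieDeriv (f : SmoothFn E M) (V : SmoothVF E M) : SmoothFn E M :=
  ⟨f.dirDeriv V, fun m => by
    have he := IsManifold.chart_mem_maximalAtlas (I := 𝓘(ℝ, E)) (n := ∞) m
    set e := chartAt E m
    have hm : m ∈ e.source := mem_chart_source E m
    have h1 : ContDiffOn ℝ ∞ (fun x => fderiv ℝ (f ∘ e.symm) x (chartRep e V x)) e.target :=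
      ((contDiffOn_comp_chart_symm he f).fderiv_of_isOpen e.open_target (by simp)).clm_apply
        (contDiffOn_chartRep he V)
    have h2 := contMDiffOn_comp_chart he h1
    refine ((h2 m ⟨hm, e.map_source hm⟩).contMDiffAt ?_).congr_of_eventuallyEq ?_
    · exact (e.isOpen_inter_preimage e.open_target).mem_nhds ⟨hm, e.map_source hm⟩
    · filter_upwards [e.open_source.mem_nhds hm] with y hy
      have := f.dirDeriv_eq_fderiv he V (e.map_source hy)
      rwa [e.left_inv hy] at this⟩

/-- In a chart the second derivatives of `f` cancel by symmetry, and the remaining first derivatives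
of the coefficients form the bracket. This is the source of flatness for the connection built from a
frame. -/
theorem SmoothFn.dirDeriv_bracket (f : SmoothFn E M) (V W : SmoothVF E M) (m : M) :
    f.dirDeriv ⁅V, W⁆ m = (f.lieDeriv W).dirDeriv V m - (f.lieDeriv V).dirDeriv W m := by
  have he := IsManifold.chart_mem_maximalAtlas (I := 𝓘(ℝ, E)) (n := ∞) m
  set e := chartAt E m
  have hm : m ∈ e.source := mem_chart_source E m
  have hx := e.map_source hm
  obtain ⟨x, hxe⟩ : ∃ x, x = e m := ⟨_, rfl⟩
  rw [← hxe] at hx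
  have hmx : m = e.symm x := by rw [hxe, e.left_inv hm]
  have hF := (contDiffOn_comp_chart_symm he f).contDiffAt (e.open_target.mem_nhds hx)
  have hF' : DifferentiableAt ℝ (fderiv ℝ (f ∘ e.symm)) x :=
    (hF.fderiv_right (m := 1) (by exact two_le_smooth)).differentiableAt (by simp)
  have hlie (V W : SmoothVF E M) : (f.lieDeriv W).dirDeriv V (e.symm x) =
      fderiv ℝ (fderiv ℝ (f ∘ e.symm)) x (chartRep e V x) (chartRep e W x)
        + fderiv ℝ (f ∘ e.symm) x (fderiv ℝ (chartRep e W) x (chartRep e V x)) := by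
    rw [SmoothFn.dirDeriv_eq_fderiv he _ _ hx]
    have h1 : (f.lieDeriv W) ∘ e.symm =ᶠ[𝓝 x]
        fun y => fderiv ℝ (f ∘ e.symm) y (chartRep e W y) := by
      filter_upwards [e.open_target.mem_nhds hx] with y hy using f.dirDeriv_eq_fderiv he W hy
    rw [h1.fderiv_eq, fderiv_clm_apply hF' (differentiableAt_chartRep he W hx)]
    simp [add_comm]
  have hsymm : IsSymmSndFDerivAt ℝ (f ∘ e.symm) x :=
    hF.isSymmSndFDerivAt (by rw [minSmoothness_of_isRCLikeNormedField]; exact two_le_smooth)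
  rw [hmx, hlie, hlie, SmoothFn.dirDeriv_eq_fderiv he _ _ hx, chartRep_bracket he _ _ hx, map_sub,
    hsymm.eq]
  abel

theorem contMDiffOn_mpullback_const (he : e ∈ IsManifold.maximalAtlas 𝓘(ℝ, E) ∞ M) (u : E) :
    ContMDiffOn 𝓘(ℝ, E) 𝓘(ℝ, E).tangent ∞
      (fun m => (⟨m, mpullback 𝓘(ℝ, E) 𝓘(ℝ, E) e (fun _ => u) m⟩ : TangentBundle 𝓘(ℝ, E) M))
      e.source := fun m hm => by
  have := FiniteDimensional.complete ℝ E
  have hd := mdifferentiable_of_mem_maximalAtlas he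
  refine (ContMDiffAt.mpullback_vectorField_preimage (n := ∞) ?_
    (contMDiffAt_of_mem_maximalAtlas he hm) ⟨hd.mfderiv hm, rfl⟩ (by simp)).contMDiffWithinAt
  exact contMDiffAt_vectorSpace_iff_contDiffAt.2 contDiffAt_const

/-- The coordinate vector field of the chart `e` in the direction `u`, multiplied by a bump
function. -/
def coordField (he : e ∈ IsManifold.maximalAtlas 𝓘(ℝ, E) ∞ M) (ψ : SmoothFn E M)
    (hψ : tsupport ψ ⊆ e.source) (u : E) : SmoothVF E M :=
  ⟨_, ContMDiffOn.smul_section_of_tsupport ψ.contMDiff.contMDiffOn e.open_source hψ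
    (contMDiffOn_mpullback_const he u)⟩

theorem coordField_apply (he : e ∈ IsManifold.maximalAtlas 𝓘(ℝ, E) ∞ M) (ψ : SmoothFn E M)
    (hψ : tsupport ψ ⊆ e.source) (u : E) (m : M) : coordField he ψ hψ u m =
      ψ m • mpullback 𝓘(ℝ, E) 𝓘(ℝ, E) e (fun _ => u) m := rfl

theorem mfderiv_mpullback_const (he : e ∈ IsManifold.maximalAtlas 𝓘(ℝ, E) ∞ M) (u : E) {m : M}
    (hm : m ∈ e.source) : mfderiv 𝓘(ℝ, E) 𝓘(ℝ, E) e m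
      (mpullback 𝓘(ℝ, E) 𝓘(ℝ, E) e (fun _ => u) m) = u := by
  have hd := mdifferentiable_of_mem_maximalAtlas he
  exact ContinuousLinearMap.IsInvertible.self_apply_inverse (f := mfderiv 𝓘(ℝ, E) 𝓘(ℝ, E) e m)
    ⟨hd.mfderiv hm, rfl⟩ u

theorem chartRep_coordField (he : e ∈ IsManifold.maximalAtlas 𝓘(ℝ, E) ∞ M) (ψ : SmoothFn E M)
    (hψ : tsupport ψ ⊆ e.source) (u : E) {x : E} (hx : x ∈ e.target) :
    chartRep e (coordField he ψ hψ u) x = ψ (e.symm x) • u := by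
  unfold chartRep
  rw [coordField_apply, map_smul]
  exact congrArg (ψ (e.symm x) • ·) (mfderiv_mpullback_const he u (e.map_target hx))

theorem coordField_add (he : e ∈ IsManifold.maximalAtlas 𝓘(ℝ, E) ∞ M) (ψ : SmoothFn E M)
    (hψ : tsupport ψ ⊆ e.source) (u v : E) :
    coordField he ψ hψ (u + v) = coordField he ψ hψ u + coordField he ψ hψ v := by
  ext m
  exact (congrArg (ψ m • ·) (map_add (mfderiv 𝓘(ℝ, E) 𝓘(ℝ, E) e m).inverse u v)).trans
    (smul_add _ _ _)

theorem coordField_smul (he : e ∈ IsManifold.maximalAtlas 𝓘(ℝ, E) ∞ M) (ψ : SmoothFn E M)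
    (hψ : tsupport ψ ⊆ e.source) (c : ℝ) (u : E) :
    coordField he ψ hψ (c • u) = c • coordField he ψ hψ u := by
  ext m
  exact (congrArg (ψ m • ·) (map_smul (mfderiv 𝓘(ℝ, E) 𝓘(ℝ, E) e m).inverse c u)).trans
    (smul_comm _ _ _)

end ChartCalculus

/-! ### Smoothness of solutions of `dG = -A G` -/

section Bootstrap

variable {E : Type*} [NormedAddCommGroup E] [NormedSpace ℝ E]
  {R : Type*} [NormedRing R] [NormedAlgebra ℝ R]

/-- Solutions of a linear total differential equation with smooth coefficients are smooth. -/
theorem contDiffOn_of_linear_pde {A : E → E →L[ℝ] R} {G : E → R} {B : Set E} (hB : IsOpen B)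
    (hA : ContDiffOn ℝ ∞ A B)
    (hG : ∀ x ∈ B, HasFDerivAt G (-(((ContinuousLinearMap.mul ℝ R).flip (G x)).comp (A x))) x) :
    ContDiffOn ℝ ∞ G B := by
  rw [contDiffOn_infty]
  intro n
  induction n with
  | zero =>
    exact contDiffOn_zero.2 fun x hx => (hG x hx).continuousAt.continuousWithinAt
  | succ n ih =>
    -- The equation expresses the derivative by `G` and the smooth `A`, so it is as regular as `G`
    -- is already known to be, which gains one order.
    rw [Nat.cast_succ, contDiffOn_succ_iff_fderiv_of_isOpen hB]
    refine ⟨fun x hx => (hG x hx).differentiableAt.differentiableWithinAt, by simp, ?_⟩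
    refine ContDiffOn.congr ?_ fun x hx => (hG x hx).fderiv
    exact (((ContinuousLinearMap.mul ℝ R).flip.contDiff.comp_contDiffOn ih).clm_comp
      (hA.of_le (by exact_mod_cast le_top))).neg

end Bootstrap

/-! ### The tangent distribution and its sections in foliated charts -/

namespace RegularFoliation

variable {E : Type*} [NormedAddCommGroup E] [NormedSpace ℝ E] [FiniteDimensional ℝ E]
  {M : Type*} [TopologicalSpace M] [ChartedSpace E M] [IsManifold 𝓘(ℝ, E) ∞ M]
  {F : RegularFoliation E M}

/-- Tangency to the foliation can be tested in a single foliated chart. -/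
theorem mem_tangent_iff {e : OpenPartialHomeomorph M E} (he : e ∈ F.charts) {m : M}
    (hm : m ∈ e.source) {v : TangentSpace 𝓘(ℝ, E) m} :
    v ∈ F.tangent m ↔ (mfderiv 𝓘(ℝ, E) 𝓘(ℝ, E) e m v : E) ∈ F.slice := by
  refine ⟨fun h => h e he hm, fun h e' he' hm' => ?_⟩
  have hd := mdifferentiable_of_mem_maximalAtlas (F.smooth he)
  have hd' := mdifferentiable_of_mem_maximalAtlas (F.smooth he')
  have hz : e m ∈ e.target := e.map_source hm
  set w : E := mfderiv 𝓘(ℝ, E) 𝓘(ℝ, E) e m v with hw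
  have hzs : e m ∈ (e.symm.trans e').source := by
    simp [hz, e.left_inv hm, hm']
  obtain ⟨U, hU, hcompat⟩ := F.compat e he e' he' (e m) hzs
  have hmd : MDifferentiableAt 𝓘(ℝ, E) 𝓘(ℝ, E) (e' ∘ e.symm) (e m) := by
    refine MDifferentiableAt.comp (e m) ?_ (hd.mdifferentiableAt_symm hz)
    rw [e.left_inv hm]
    exact hd'.mdifferentiableAt hm'
  have hchain : (mfderiv 𝓘(ℝ, E) 𝓘(ℝ, E) e' m v : E) = fderiv ℝ (e' ∘ e.symm) (e m) w := by
    have h1 : e' =ᶠ[𝓝 m] (e' ∘ e.symm) ∘ e := by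
      filter_upwards [e.open_source.mem_nhds hm] with y hy
      simp [e.left_inv hy]
    rw [h1.mfderiv_eq, mfderiv_comp m hmd (hd.mdifferentiableAt hm), mfderiv_eq_fderiv]
    rfl
  rw [hchain]
  have hfd : DifferentiableAt ℝ (e' ∘ e.symm) (e m) := mdifferentiableAt_iff_differentiableAt.1 hmd
  have hline : HasDerivAt (fun t : ℝ => e m + t • w) w 0 := by
    simpa using ((hasDerivAt_id (0 : ℝ)).smul_const w).const_add (e m)
  have hcomp : HasDerivAt (fun t : ℝ => (e' ∘ e.symm) (e m + t • w))
      (fderiv ℝ (e' ∘ e.symm) (e m) w) 0 := by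
    have : HasFDerivAt (e' ∘ e.symm) (fderiv ℝ (e' ∘ e.symm) (e m)) (e m + (0 : ℝ) • w) := by
      simpa using hfd.hasFDerivAt
    exact this.comp_hasDerivAt (0 : ℝ) hline
  -- The derivative of the transition map in a slice direction is a limit of difference quotients,
  -- which lie in the slice direction by `F.compat`. A finite-dimensional subspace contains such
  -- limits.
  have hP : IsClosed (F.slice : Set E) := F.slice.closed_of_finiteDimensional
  refine hP.mem_of_tendsto hcomp.tendsto_slope ?_
  have hc : Tendsto (fun t : ℝ => e m + t • w) (𝓝[≠] 0) (𝓝 (e m)) := by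
    have := hline.continuousAt.tendsto
    simp only [zero_smul, add_zero] at this
    exact this.mono_left nhdsWithin_le_nhds
  filter_upwards [hc.eventually hU] with t ht
  rw [slope_def_module]
  refine F.slice.smul_mem _ ?_
  have := hcompat (e m) (mem_of_mem_nhds hU) (e m + t • w) ht
    (by simpa using F.slice.smul_mem t h)
  simpa using this

theorem chartRep_mem_slice {e : OpenPartialHomeomorph M E} (he : e ∈ F.charts) (X : F.sections)
    {x : E} (hx : x ∈ e.target) : chartRep e X x ∈ F.slice :=
  X.2 _ e he (e.map_target hx)

theorem sections_coe_add (X Y : F.sections) :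
    ((X + Y : F.sections) : SmoothVF E M) = (X : SmoothVF E M) + (Y : SmoothVF E M) := rfl

theorem sections_coe_smulFn (f : SmoothFn E M) (X : F.sections) :
    ((f • X : F.sections) : SmoothVF E M) = f • (X : SmoothVF E M) := rfl

theorem sections_coe_sum {ι : Type*} (s : Finset ι) (X : ι → F.sections) :
    ((∑ i ∈ s, X i : F.sections) : SmoothVF E M) = ∑ i ∈ s, (X i : SmoothVF E M) :=
  map_sum F.sections.toSubmodule.subtype X s

variable (F) in
/-- A coordinate model for the direction of the slices. -/
def SliceModel : Type := Fin (Module.finrank ℝ F.slice) → ℝ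

instance : NormedAddCommGroup F.SliceModel :=
  inferInstanceAs (NormedAddCommGroup (Fin (Module.finrank ℝ F.slice) → ℝ))

instance : NormedSpace ℝ F.SliceModel :=
  inferInstanceAs (NormedSpace ℝ (Fin (Module.finrank ℝ F.slice) → ℝ))

instance : FiniteDimensional ℝ F.SliceModel :=
  inferInstanceAs (FiniteDimensional ℝ (Fin (Module.finrank ℝ F.slice) → ℝ))

variable (F) in
/-- The coordinates of the direction of the slices. -/
def sliceEquiv : F.SliceModel ≃ₗ[ℝ] F.slice := (Module.finBasis ℝ F.slice).equivFun.symm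

variable (F) in
/-- The inclusion of the direction of the slices into the model space. -/
def sliceIncl : F.SliceModel →L[ℝ] E :=
  LinearMap.toContinuousLinearMap (F.slice.subtype ∘ₗ F.sliceEquiv.toLinearMap)

theorem sliceIncl_mem (u : F.SliceModel) : F.sliceIncl u ∈ F.slice :=
  (F.sliceEquiv u).2

theorem exists_sliceIncl_eq {v : E} (hv : v ∈ F.slice) : ∃ u, F.sliceIncl u = v :=
  ⟨F.sliceEquiv.symm ⟨v, hv⟩, congrArg Subtype.val (F.sliceEquiv.apply_symm_apply ⟨v, hv⟩)⟩

theorem exists_sliceIncl_leftInverse :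
    ∃ g : E →ₗ[ℝ] F.SliceModel, g ∘ₗ (F.sliceIncl : F.SliceModel →ₗ[ℝ] E) = LinearMap.id :=
  LinearMap.exists_leftInverse_of_injective _ (LinearMap.ker_eq_bot.2 fun _ _ h =>
    F.sliceEquiv.injective (Subtype.ext h))

variable (F) in
/-- A linear projection of the model space onto the direction of the slices. -/
def sliceProj : E →L[ℝ] F.SliceModel :=
  LinearMap.toContinuousLinearMap (Classical.choose (exists_sliceIncl_leftInverse (F := F)))

theorem sliceProj_sliceIncl (u : F.SliceModel) : F.sliceProj (F.sliceIncl u) = u :=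
  LinearMap.congr_fun (Classical.choose_spec (exists_sliceIncl_leftInverse (F := F))) u

theorem sliceIncl_sliceProj {v : E} (hv : v ∈ F.slice) : F.sliceIncl (F.sliceProj v) = v := by
  obtain ⟨u, rfl⟩ := exists_sliceIncl_eq hv
  rw [sliceProj_sliceIncl]

/-- The coordinate field of a foliated chart in the direction of a slice, as a section of the
tangent distribution. -/
def coordSection {e : OpenPartialHomeomorph M E} (he : e ∈ F.charts) (ψ : SmoothFn E M)
    (hψ : tsupport ψ ⊆ e.source) (u : F.SliceModel) : F.sections :=
  ⟨coordField (F.smooth he) ψ hψ (F.sliceIncl u), fun m => by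
    by_cases hm : m ∈ e.source
    · rw [mem_tangent_iff he hm, coordField_apply, map_smul]
      refine F.slice.smul_mem _ ?_
      exact (congrArg (· ∈ F.slice) (mfderiv_mpullback_const (F.smooth he) (F.sliceIncl u) hm)).mpr (sliceIncl_mem u)
    · rw [coordField_apply, image_eq_zero_of_notMem_tsupport fun h => hm (hψ h), zero_smul]
      exact (F.tangent m).zero_mem⟩

theorem coordSection_coe {e : OpenPartialHomeomorph M E} (he : e ∈ F.charts) (ψ : SmoothFn E M)
    (hψ : tsupport ψ ⊆ e.source) (u : F.SliceModel) :
    (coordSection he ψ hψ u : SmoothVF E M) = coordField (F.smooth he) ψ hψ (F.sliceIncl u) := rfl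

/-- The coordinate representation of a section of the tangent distribution. -/
def sectionRep (e : OpenPartialHomeomorph M E) (X : F.sections) (x : E) : F.SliceModel :=
  F.sliceProj (chartRep e X x)

theorem sliceIncl_sectionRep {e : OpenPartialHomeomorph M E} (he : e ∈ F.charts) (X : F.sections) {x : E}
    (hx : x ∈ e.target) : F.sliceIncl (sectionRep e X x) = chartRep e X x :=
  sliceIncl_sliceProj (chartRep_mem_slice he X hx)

theorem contDiffOn_sectionRep {e : OpenPartialHomeomorph M E} (he : e ∈ F.charts)
    (X : F.sections) : ContDiffOn ℝ ∞ (sectionRep e X) e.target :=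
  F.sliceProj.contDiff.comp_contDiffOn (contDiffOn_chartRep (F.smooth he) X)

theorem differentiableAt_sectionRep {e : OpenPartialHomeomorph M E} (he : e ∈ F.charts)
    (X : F.sections) {x : E} (hx : x ∈ e.target) : DifferentiableAt ℝ (sectionRep e X) x :=
  ((contDiffOn_sectionRep he X).contDiffAt (e.open_target.mem_nhds hx)).differentiableAt (by simp)

/-! ### Linearity and locality of a connection -/

namespace Connection

variable (C : F.Connection)

theorem cov_sub_right (V : SmoothVF E M) (X Y : F.sections) :
    C.cov V (X - Y) = C.cov V X - C.cov V Y := by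
  rw [eq_sub_iff_add_eq, ← C.add_right, sub_add_cancel]

theorem cov_sub_left (V W : SmoothVF E M) (X : F.sections) :
    C.cov (V - W) X = C.cov V X - C.cov W X := by
  rw [eq_sub_iff_add_eq, ← C.add_left, sub_add_cancel]

theorem cov_zero_right (V : SmoothVF E M) : C.cov V 0 = 0 := by
  have := C.cov_sub_right V 0 0
  simpa using this

theorem cov_zero_left (X : F.sections) : C.cov 0 X = 0 := by
  have := C.cov_sub_left 0 0 X
  simpa using this

theorem cov_sum_right {ι : Type*} (s : Finset ι) (V : SmoothVF E M) (X : ι → F.sections) :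
    C.cov V (∑ i ∈ s, X i) = ∑ i ∈ s, C.cov V (X i) := by
  classical
  induction s using Finset.induction_on with
  | empty => simpa using C.cov_zero_right V
  | insert i s hi ih => rw [Finset.sum_insert hi, Finset.sum_insert hi, C.add_right, ih]

theorem cov_sum_left {ι : Type*} (s : Finset ι) (V : ι → SmoothVF E M) (X : F.sections) :
    C.cov (∑ i ∈ s, V i) X = ∑ i ∈ s, C.cov (V i) X := by
  classical
  induction s using Finset.induction_on with
  | empty => simpa using C.cov_zero_left X
  | insert i s hi ih => rw [Finset.sum_insert hi, Finset.sum_insert hi, C.add_left, ih]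

theorem cov_const_smul_right (V : SmoothVF E M) (c : ℝ) (X : F.sections) :
    C.cov V (c • X) = c • C.cov V X := by
  let k : SmoothFn E M := ⟨fun _ => c, contMDiff_const⟩
  have h : c • X = k • X := rfl
  rw [h]
  apply Subtype.ext
  ext m
  refine (C.leibniz _ V X m).trans ?_
  have h0 : k.dirDeriv V m = 0 := by
    have : mfderiv 𝓘(ℝ, E) 𝓘(ℝ, ℝ) (fun _ : M => c) m = 0 := mfderiv_const
    exact DFunLike.congr_fun this (V m)
  rw [h0, zero_smul, add_zero]
  rfl

theorem cov_const_smul_left (V : SmoothVF E M) (c : ℝ) (X : F.sections) :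
    C.cov (c • V) X = c • C.cov V X := by
  let k : SmoothFn E M := ⟨fun _ => c, contMDiff_const⟩
  have h : c • V = k • V := rfl
  rw [h, C.smul_left]
  rfl

variable [T2Space M]

/-- A bump function `ψ` equal to one near `m` and supported where `X` vanishes has `ψ • X = 0`. The
Leibniz rule at `m`, where also `X m = 0`, then reduces to the claim. -/
theorem cov_eq_zero_of_eventually (V : SmoothVF E M) {X : F.sections} {m : M}
    (hX : ∀ᶠ y in 𝓝 m, (X : SmoothVF E M) y = 0) : (C.cov V X : SmoothVF E M) m = 0 := by
  obtain ⟨ψ, hψ, hψ1⟩ := exists_smooth_bump (E := E) hX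
  have h0 : ψ • X = 0 := by
    apply Subtype.ext
    ext y
    by_cases hy : y ∈ tsupport ψ
    · exact (congrArg (ψ y • ·) (hψ hy)).trans (smul_zero _)
    · exact (congrArg (· • (X : SmoothVF E M) y) (image_eq_zero_of_notMem_tsupport hy)).trans
        (zero_smul _ _)
  have h1 := C.leibniz ψ V X m
  rw [h0, C.cov_zero_right, hX.self_of_nhds, smul_zero, add_zero, hψ1.self_of_nhds, one_smul] at h1
  exact h1.symm

/-- The covariant derivative is a local operator. -/
theorem cov_congr (V : SmoothVF E M) {X Y : F.sections} {m : M}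
    (hX : ∀ᶠ y in 𝓝 m, (X : SmoothVF E M) y = (Y : SmoothVF E M) y) :
    (C.cov V X : SmoothVF E M) m = (C.cov V Y : SmoothVF E M) m := by
  have h := C.cov_eq_zero_of_eventually V (X := X - Y) (m := m)
    (hX.mono fun y hy => sub_eq_zero.2 hy)
  rw [cov_sub_right] at h
  exact sub_eq_zero.1 h

theorem cov_left_eq_zero_of_eventually {V : SmoothVF E M} (X : F.sections) {m : M}
    (hV : ∀ᶠ y in 𝓝 m, V y = 0) : (C.cov V X : SmoothVF E M) m = 0 := by
  obtain ⟨ψ, hψ, hψ1⟩ := exists_smooth_bump (E := E) hV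
  have h0 : ψ • V = 0 := by
    ext y
    by_cases hy : y ∈ tsupport ψ
    · exact (congrArg (ψ y • ·) (hψ hy)).trans (smul_zero _)
    · exact (congrArg (· • V y) (image_eq_zero_of_notMem_tsupport hy)).trans (zero_smul _ _)
  have h1 := congrArg (fun Z : F.sections => (Z : SmoothVF E M) m) (C.smul_left ψ V X)
  simp only [h0, C.cov_zero_left] at h1
  have h2 : (ψ m • (C.cov V X : SmoothVF E M) m) = 0 := h1.symm
  rwa [hψ1.self_of_nhds, one_smul] at h2

/-- Near `m` the field `V` is a combination of cut-off coordinate fields with smooth coefficients,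
and these coefficients vanish at `m`. Function-linearity then gives zero; locality in `V` justifies
replacing `V` by the combination. -/
theorem cov_left_eq_zero {V : SmoothVF E M} (X : F.sections) {m : M} (hV : V m = 0) :
    (C.cov V X : SmoothVF E M) m = 0 := by
  have he := IsManifold.chart_mem_maximalAtlas (I := 𝓘(ℝ, E)) (n := ∞) m
  set e := chartAt E m
  have hm : m ∈ e.source := mem_chart_source E m
  obtain ⟨ψ, hψ, hψ1⟩ := exists_smooth_bump (E := E) (e.open_source.mem_nhds hm)
  set b := Module.finBasis ℝ E
  have hsm (i) : ContMDiffOn 𝓘(ℝ, E) 𝓘(ℝ, ℝ) ∞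
      (fun y => b.coord i (chartRep e V (e y))) e.source := by
    have h1 : ContDiffOn ℝ ∞ (fun x => b.coord i (chartRep e V x)) e.target :=
      (LinearMap.toContinuousLinearMap (b.coord i)).contDiff.comp_contDiffOn
        (contDiffOn_chartRep he V)
    exact (contMDiffOn_comp_chart he h1).mono fun y hy => ⟨hy, e.map_source hy⟩
  let W : SmoothVF E M := ∑ i, (ψ.cutoff e.open_source hψ _ (hsm i)) • coordField he ψ hψ (b i)
  have hVW : ∀ᶠ y in 𝓝 m, (V - W) y = 0 := by
    filter_upwards [hψ1, e.open_source.mem_nhds hm] with y hy1 hy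
    have h2 : V y = W y := by
      refine chartRep_injective he hy ?_
      rw [chartRep_sum]
      simp only [chartRep_smulFn, chartRep_coordField he ψ hψ _ (e.map_source hy),
        SmoothFn.cutoff_apply, e.left_inv hy, hy1, one_mul, one_smul]
      exact (b.sum_repr _).symm
    exact sub_eq_zero.2 h2
  have h3 := C.cov_left_eq_zero_of_eventually X hVW
  rw [cov_sub_left] at h3
  have h4 : (C.cov V X : SmoothVF E M) m = (C.cov W X : SmoothVF E M) m := sub_eq_zero.1 h3
  rw [h4]
  have h0 : chartRep e V (e m) = 0 := by
    rw [chartRep_apply_self hm, hV]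
    exact map_zero (mfderiv 𝓘(ℝ, E) 𝓘(ℝ, E) e m)
  have h5 : C.cov W X = ∑ i, (ψ.cutoff e.open_source hψ _ (hsm i)) •
      C.cov (coordField he ψ hψ (b i)) X := by
    rw [C.cov_sum_left]
    exact Finset.sum_congr rfl fun i _ => C.smul_left _ _ _
  have h6 : chartRep e (C.cov W X : SmoothVF E M) (e m) = chartRep e (0 : SmoothVF E M) (e m) := by
    rw [h5, sections_coe_sum, chartRep_sum, chartRep_zero]
    refine Finset.sum_eq_zero fun i _ => ?_
    rw [sections_coe_smulFn, chartRep_smulFn, SmoothFn.cutoff_apply, e.left_inv hm, h0, map_zero,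
      mul_zero, zero_smul]
  exact chartRep_injective he hm h6

/-- The covariant derivative is tensorial in the direction of differentiation. -/
theorem cov_left_congr {V W : SmoothVF E M} (X : F.sections) {m : M} (h : V m = W m) :
    (C.cov V X : SmoothVF E M) m = (C.cov W X : SmoothVF E M) m := by
  have := C.cov_left_eq_zero (V := V - W) X (m := m) (sub_eq_zero.2 h)
  rw [cov_sub_left] at this
  exact sub_eq_zero.1 this

theorem sectionRep_cov_smulFn {e : OpenPartialHomeomorph M E} (f : SmoothFn E M) (V : SmoothVF E M)
    (X : F.sections) (x : E) : sectionRep e (C.cov V (f • X)) x =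
      f (e.symm x) • sectionRep e (C.cov V X) x + f.dirDeriv V (e.symm x) • sectionRep e X x := by
  unfold sectionRep chartRep
  rw [C.leibniz, map_add, map_smul, map_smul]
  exact (map_add F.sliceProj _ _).trans
    (congrArg₂ (· + ·) (map_smul F.sliceProj _ _) (map_smul F.sliceProj _ _))

end Connection

theorem sectionRep_add (e : OpenPartialHomeomorph M E) (X Y : F.sections) (x : E) :
    sectionRep e (X + Y) x = sectionRep e X x + sectionRep e Y x := by
  unfold sectionRep
  rw [sections_coe_add, chartRep_add, map_add]

theorem sectionRep_sub (e : OpenPartialHomeomorph M E) (X Y : F.sections) (x : E) :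
    sectionRep e (X - Y) x = sectionRep e X x - sectionRep e Y x := by
  rw [eq_sub_iff_add_eq, ← sectionRep_add, sub_add_cancel]

theorem sectionRep_sum (e : OpenPartialHomeomorph M E) {ι : Type*} (s : Finset ι)
    (X : ι → F.sections) (x : E) :
    sectionRep e (∑ i ∈ s, X i) x = ∑ i ∈ s, sectionRep e (X i) x := by
  unfold sectionRep
  rw [sections_coe_sum, chartRep_sum, map_sum]

theorem sectionRep_smul (e : OpenPartialHomeomorph M E) (c : ℝ) (X : F.sections) (x : E) :
    sectionRep e (c • X) x = c • sectionRep e X x := by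
  unfold sectionRep
  exact (congrArg F.sliceProj (chartRep_smul e c X x)).trans (map_smul F.sliceProj _ _)

theorem sectionRep_smulFn (e : OpenPartialHomeomorph M E) (f : SmoothFn E M) (X : F.sections)
    (x : E) : sectionRep e (f • X) x = f (e.symm x) • sectionRep e X x := by
  unfold sectionRep
  rw [sections_coe_smulFn, chartRep_smulFn, map_smul]

theorem sectionRep_zero (e : OpenPartialHomeomorph M E) (x : E) :
    sectionRep e (0 : F.sections) x = 0 := by
  have := sectionRep_sub e (0 : F.sections) 0 x
  simpa using this

theorem sectionRep_congr {e : OpenPartialHomeomorph M E} {X Y : F.sections} {x : E}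
    (h : (X : SmoothVF E M) (e.symm x) = (Y : SmoothVF E M) (e.symm x)) :
    sectionRep e X x = sectionRep e Y x := by
  unfold sectionRep chartRep
  rw [h]

theorem sectionRep_injective {e : OpenPartialHomeomorph M E} (he : e ∈ F.charts) {x : E}
    (hx : x ∈ e.target) {X Y : F.sections} (h : sectionRep e X x = sectionRep e Y x) :
    (X : SmoothVF E M) (e.symm x) = (Y : SmoothVF E M) (e.symm x) := by
  refine chartRep_injective (F.smooth he) (e.map_target hx) ?_
  rw [e.right_inv hx, ← sliceIncl_sectionRep he X hx, h, sliceIncl_sectionRep he Y hx]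

theorem sectionRep_coordSection {e : OpenPartialHomeomorph M E} (he : e ∈ F.charts)
    (ψ : SmoothFn E M) (hψ : tsupport ψ ⊆ e.source) (u : F.SliceModel) {x : E} (hx : x ∈ e.target) :
    sectionRep e (coordSection he ψ hψ u) x = ψ (e.symm x) • u := by
  unfold sectionRep
  rw [coordSection_coe, chartRep_coordField _ _ _ _ hx, map_smul, sliceProj_sliceIncl]

theorem coordSection_add {e : OpenPartialHomeomorph M E} (he : e ∈ F.charts)
    (ψ : SmoothFn E M) (hψ : tsupport ψ ⊆ e.source) (u v : F.SliceModel) :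
    coordSection he ψ hψ (u + v) = coordSection he ψ hψ u + coordSection he ψ hψ v :=
  Subtype.ext ((congrArg (coordField (F.smooth he) ψ hψ) (map_add F.sliceIncl u v)).trans
    (coordField_add (F.smooth he) ψ hψ _ _))

theorem coordSection_smul {e : OpenPartialHomeomorph M E} (he : e ∈ F.charts)
    (ψ : SmoothFn E M) (hψ : tsupport ψ ⊆ e.source) (c : ℝ) (u : F.SliceModel) :
    coordSection he ψ hψ (c • u) = c • coordSection he ψ hψ u :=
  Subtype.ext ((congrArg (coordField (F.smooth he) ψ hψ) (map_smul F.sliceIncl c u)).trans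
    (coordField_smul (F.smooth he) ψ hψ c _))

end RegularFoliation

theorem eventually_norm_lt_add_one {X G : Type*} [TopologicalSpace X] [NormedAddCommGroup G]
    {f : X → G} {z : X} (hf : ContinuousAt f z) : ∀ᶠ x in 𝓝 z, ‖f x‖ < ‖f z‖ + 1 :=
  hf.norm.eventually_lt continuousAt_const (lt_add_one _)

namespace RegularFoliation

variable {E : Type*} [NormedAddCommGroup E] [NormedSpace ℝ E] [FiniteDimensional ℝ E]
  {M : Type*} [TopologicalSpace M] [ChartedSpace E M] [IsManifold 𝓘(ℝ, E) ∞ M]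
  {F : RegularFoliation E M}

/-! ### Extension of locally defined sections by bump functions -/

section Extend

variable {e : OpenPartialHomeomorph M E} {ψ χ : SmoothFn E M} {B : Set E} {g : E → F.SliceModel}

theorem contMDiffOn_slice_coord (he : e ∈ F.charts) (hg : ContDiffOn ℝ ∞ g B) (i) : ContMDiffOn 𝓘(ℝ, E) 𝓘(ℝ, ℝ) ∞
    (fun m => (Module.finBasis ℝ F.SliceModel).coord i (g (e m))) (e.source ∩ e ⁻¹' B) :=
  contMDiffOn_comp_chart (F.smooth he) (g := fun x => (Module.finBasis ℝ F.SliceModel).coord i (g x))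
    ((LinearMap.toContinuousLinearMap ((Module.finBasis ℝ F.SliceModel).coord i)).contDiff.comp_contDiffOn
      hg)

/-- The extension by a bump function of a section of the tangent distribution given in a foliated
chart, as a combination of coordinate sections. -/
def extendSection (he : e ∈ F.charts) (hψ : tsupport ψ ⊆ e.source) (hB : IsOpen B)
    (hχ : tsupport χ ⊆ e.source ∩ e ⁻¹' B) (hg : ContDiffOn ℝ ∞ g B) : F.sections :=
  -- Two cut-offs are needed: `χ` is supported where the coefficients of `g` are smooth, and `ψ`
  -- makes the coordinate sections global.
  ∑ i, (χ.cutoff (e.isOpen_inter_preimage hB) hχ _ (contMDiffOn_slice_coord he hg i)) •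
    coordSection he ψ hψ (Module.finBasis ℝ F.SliceModel i)

theorem sectionRep_extendSection (he : e ∈ F.charts) (hψ : tsupport ψ ⊆ e.source) (hB : IsOpen B)
    (hχ : tsupport χ ⊆ e.source ∩ e ⁻¹' B) (hg : ContDiffOn ℝ ∞ g B)
    {x : E} (hx : x ∈ e.target) (h1 : ψ (e.symm x) = 1)
    (h2 : χ (e.symm x) = 1) : sectionRep e (extendSection he hψ hB hχ hg) x = g x := by
  unfold extendSection
  rw [sectionRep_sum]
  simp only [sectionRep_smulFn, sectionRep_coordSection he ψ hψ _ hx, h1, SmoothFn.cutoff_apply, h2,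
    one_mul, one_smul, e.right_inv hx]
  exact (Module.finBasis ℝ F.SliceModel).sum_repr (g x)

end Extend

/-! ### The connection form in a foliated chart -/

namespace Connection

variable (C : F.Connection)

section Form

variable {e : OpenPartialHomeomorph M E}

/-- The bilinear map underlying the connection form in a foliated chart. -/
def formBilin (he : e ∈ F.charts) (ψ : SmoothFn E M)
    (hψ : tsupport ψ ⊆ e.source) (x : E) : E →ₗ[ℝ] F.SliceModel →ₗ[ℝ] F.SliceModel :=
  LinearMap.mk₂ ℝ (fun v u => sectionRep e
      (C.cov (coordField (F.smooth he) ψ hψ v) (coordSection he ψ hψ u)) x)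
    (fun v w u => by rw [coordField_add, C.add_left, sectionRep_add])
    (fun c v u => by rw [coordField_smul, C.cov_const_smul_left, sectionRep_smul])
    (fun v u w => by rw [coordSection_add, C.add_right, sectionRep_add])
    (fun c v u => by rw [coordSection_smul, C.cov_const_smul_right, sectionRep_smul])

/-- The connection form in a foliated chart. -/
def form (he : e ∈ F.charts) (ψ : SmoothFn E M)
    (hψ : tsupport ψ ⊆ e.source) (x : E) : E →L[ℝ] F.SliceModel →L[ℝ] F.SliceModel :=
  LinearMap.toContinuousLinearMap
    ((LinearMap.toContinuousLinearMap : (F.SliceModel →ₗ[ℝ] F.SliceModel) ≃ₗ[ℝ] _).toLinearMap ∘ₗ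
      C.formBilin he ψ hψ x)

theorem form_apply (he : e ∈ F.charts) (ψ : SmoothFn E M)
    (hψ : tsupport ψ ⊆ e.source) (x v : E) (u : F.SliceModel) : C.form he ψ hψ x v u = sectionRep e
    (C.cov (coordField (F.smooth he) ψ hψ v) (coordSection he ψ hψ u)) x := rfl

theorem contDiffOn_form (he : e ∈ F.charts) (ψ : SmoothFn E M)
    (hψ : tsupport ψ ⊆ e.source) : ContDiffOn ℝ ∞ (C.form he ψ hψ) e.target :=
  contDiffOn_clm_apply.2 fun v => contDiffOn_clm_apply.2 fun u =>
    contDiffOn_sectionRep he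
      (C.cov (coordField (F.smooth he) ψ hψ v) (coordSection he ψ hψ u))

theorem differentiableAt_form (he : e ∈ F.charts) (ψ : SmoothFn E M)
    (hψ : tsupport ψ ⊆ e.source) {x : E} (hx : x ∈ e.target) :
    DifferentiableAt ℝ (C.form he ψ hψ) x :=
  ((C.contDiffOn_form he ψ hψ).contDiffAt (e.open_target.mem_nhds hx)).differentiableAt (by simp)

variable [T2Space M] {ψ : SmoothFn E M}

theorem sectionRep_cov_left_congr (he : e ∈ F.charts) {V W : SmoothVF E M} (X : F.sections) {x : E} (hx : x ∈ e.target)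
    (h : chartRep e V x = chartRep e W x) :
    sectionRep e (C.cov V X) x = sectionRep e (C.cov W X) x := by
  refine sectionRep_congr (C.cov_left_congr X ?_)
  rw [← e.right_inv hx] at h
  exact chartRep_injective (F.smooth he) (e.map_target hx) h

theorem sectionRep_cov_congr (he : e ∈ F.charts) (V : SmoothVF E M) {X Y : F.sections} {x : E} (hx : x ∈ e.target)
    (h : ∀ᶠ y in 𝓝 x, sectionRep e X y = sectionRep e Y y) :
    sectionRep e (C.cov V X) x = sectionRep e (C.cov V Y) x := by
  refine sectionRep_congr (C.cov_congr V ?_)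
  have h1 : ∀ᶠ m in 𝓝 (e.symm x), sectionRep e X (e m) = sectionRep e Y (e m) := by
    have := e.continuousAt (e.map_target hx)
    rw [ContinuousAt, e.right_inv hx] at this
    exact this.eventually h
  filter_upwards [h1, e.open_source.mem_nhds (e.map_target hx)] with m hm hms
  have := sectionRep_injective he (e.map_source hms) hm
  rwa [e.left_inv hms] at this

/-- The coordinate expression of the covariant derivative. -/
theorem sectionRep_cov (he : e ∈ F.charts)
    (hψ : tsupport ψ ⊆ e.source) (V : SmoothVF E M) (X : F.sections) {x : E} (hx : x ∈ e.target)
    (h1 : ∀ᶠ y in 𝓝 x, ψ (e.symm y) = 1) : sectionRep e (C.cov V X) x =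
      fderiv ℝ (sectionRep e X) x (chartRep e V x)
        + C.form he ψ hψ x (chartRep e V x) (sectionRep e X x) := by
  let b := Module.finBasis ℝ F.SliceModel
  have hψ' : tsupport ψ ⊆ e.source ∩ e ⁻¹' e.target := fun m hm => ⟨hψ hm, e.map_source (hψ hm)⟩
  -- By locality `X` may be replaced near `x` by a combination of coordinate sections, to which the
  -- Leibniz rule applies: the derivatives of the coefficients give the first term of the formula,
  -- and the derivatives of the coordinate sections give the form.
  have hloc : ∀ᶠ y in 𝓝 x, sectionRep e X y = sectionRep e (extendSection he hψ e.open_target hψ'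
      (contDiffOn_sectionRep he X)) y := by
    filter_upwards [h1, e.open_target.mem_nhds hx] with y hy hyt
    exact (sectionRep_extendSection he hψ e.open_target hψ' _ hyt hy hy).symm
  rw [C.sectionRep_cov_congr he V hx hloc]
  unfold extendSection
  rw [C.cov_sum_right, sectionRep_sum]
  change ∑ i, sectionRep e (C.cov V (_ • coordSection he ψ hψ (b i))) x = _
  have hcov (i) : sectionRep e (C.cov V (coordSection he ψ hψ (b i))) x =
      C.form he ψ hψ x (chartRep e V x) (b i) := by
    rw [form_apply]
    refine C.sectionRep_cov_left_congr he _ hx ?_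
    rw [chartRep_coordField _ _ _ _ hx, h1.self_of_nhds, one_smul]
  have hder (i) : (ψ.cutoff (e.isOpen_inter_preimage e.open_target) hψ' _
      (contMDiffOn_slice_coord he (contDiffOn_sectionRep he X) i)).dirDeriv V (e.symm x) =
      b.coord i (fderiv ℝ (sectionRep e X) x (chartRep e V x)) := by
    rw [SmoothFn.dirDeriv_eq_fderiv (F.smooth he) _ _ hx]
    have h2 : (ψ.cutoff (e.isOpen_inter_preimage e.open_target) hψ' _
        (contMDiffOn_slice_coord he (contDiffOn_sectionRep he X) i)) ∘ e.symm =ᶠ[𝓝 x]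
        (LinearMap.toContinuousLinearMap (b.coord i)) ∘ sectionRep e X := by
      filter_upwards [h1, e.open_target.mem_nhds hx] with y hy hyt
      simp only [Function.comp_apply, SmoothFn.cutoff_apply, hy, one_mul, e.right_inv hyt]
      rfl
    rw [h2.fderiv_eq, ((LinearMap.toContinuousLinearMap (b.coord i)).hasFDerivAt.comp x
      (differentiableAt_sectionRep he X hx).hasFDerivAt).fderiv]
    rfl
  simp only [sectionRep_cov_smulFn, hder, hcov, SmoothFn.cutoff_apply, e.right_inv hx,
    h1.self_of_nhds, one_mul, sectionRep_coordSection he ψ hψ _ hx, one_smul]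
  rw [Finset.sum_add_distrib, add_comm]
  congr 1
  · exact b.sum_repr _
  · conv_rhs => rw [← b.sum_repr (sectionRep e X x), map_sum]
    refine Finset.sum_congr rfl fun i _ => ?_
    rw [map_smul]
    rfl

set_option synthInstance.maxHeartbeats 200000 in
/-- The connection form of a flat connection satisfies the structure equation. -/
theorem form_flat (he : e ∈ F.charts)
    (hψ : tsupport ψ ⊆ e.source) (hC : C.IsFlat) {x : E} (hx : x ∈ e.target)
    (h1 : ∀ᶠ y in 𝓝 x, ψ (e.symm y) = 1) (v w : E) :
    fderiv ℝ (C.form he ψ hψ) x v w - fderiv ℝ (C.form he ψ hψ) x w v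
      + (C.form he ψ hψ x v * C.form he ψ hψ x w - C.form he ψ hψ x w * C.form he ψ hψ x v) = 0 := by
  ext1 u
  set V := coordField (F.smooth he) ψ hψ
  set X := coordSection he ψ hψ u with hX
  have hV (v : E) : ∀ᶠ y in 𝓝 x, chartRep e (V v) y = v := by
    filter_upwards [h1, e.open_target.mem_nhds hx] with y hy hyt
    rw [chartRep_coordField _ _ _ _ hyt, hy, one_smul]
  have hcov (v w : E) : sectionRep e (C.cov (V v) (C.cov (V w) X)) x =
      fderiv ℝ (C.form he ψ hψ) x v w u + C.form he ψ hψ x v (C.form he ψ hψ x w u) := by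
    rw [C.sectionRep_cov he hψ _ _ hx h1, (hV v).self_of_nhds]
    congr 1
    have h2 : sectionRep e (C.cov (V w) X) = fun y => C.form he ψ hψ y w u := rfl
    have h3 := ((C.differentiableAt_form he ψ hψ hx).hasFDerivAt.clm_apply
      (hasFDerivAt_const w x)).clm_apply (hasFDerivAt_const u x)
    rw [h2, h3.fderiv]
    simp
  -- The coordinate fields are constant near `x`, so their bracket vanishes there and drops out of
  -- the curvature.
  have hbr : sectionRep e (C.cov ⁅V v, V w⁆ X) x = 0 := by
    have h2 : chartRep e ⁅V v, V w⁆ x = chartRep e (0 : SmoothVF E M) x := by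
      have h3 (v : E) : fderiv ℝ (chartRep e (V v)) x = 0 := by
        rw [EventuallyEq.fderiv_eq (hV v), fderiv_fun_const]
        rfl
      rw [chartRep_bracket (F.smooth he) _ _ hx, h3, h3, chartRep_zero]
      simp
    rw [C.sectionRep_cov_left_congr he X hx h2, C.cov_zero_left, sectionRep_zero]
  have h4 := congrArg (fun Z => sectionRep e Z x) (hC (V v) (V w) X)
  simp only [sectionRep_sub, sectionRep_zero, hcov, hbr, sub_zero] at h4
  simp only [add_apply, sub_apply, mul_apply_eq_comp, zero_apply]
  rw [← h4]
  abel

end Form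

/-! ### Parallel sections: local uniqueness and local existence -/

/-- A section is parallel at a point if all its covariant derivatives vanish there. -/
def ParallelAt (X : F.sections) (m : M) : Prop :=
  ∀ V : SmoothVF E M, (C.cov V X : SmoothVF E M) m = 0

variable [T2Space M]

theorem parallelAt_sub {X Y : F.sections} {m : M} (hX : C.ParallelAt X m) (hY : C.ParallelAt Y m) :
    C.ParallelAt (X - Y) m := by
  intro V
  rw [cov_sub_right]
  have h : (C.cov V X : SmoothVF E M) m - (C.cov V Y : SmoothVF E M) m = 0 := by
    rw [hX V, hY V, sub_zero]
  exact h

theorem parallelAt_congr {X Y : F.sections} {m : M}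
    (h : ∀ᶠ y in 𝓝 m, (X : SmoothVF E M) y = (Y : SmoothVF E M) y) (hX : C.ParallelAt X m) :
    C.ParallelAt Y m := fun V => by rw [← C.cov_congr V h, hX V]

/-- A chart with a bump function equal to one on an open set around the given point. -/
theorem exists_chart_bump (F : RegularFoliation E M) (m : M) :
    ∃ e ∈ F.charts, ∃ ψ : SmoothFn E M, m ∈ e.source ∧ tsupport ψ ⊆ e.source ∧
      ∀ᶠ x in 𝓝 (e m), ψ (e.symm x) = 1 := by
  obtain ⟨e, he, hm⟩ := F.cover m
  obtain ⟨ψ, hψ, hψ1⟩ := exists_smooth_bump (E := E) (e.open_source.mem_nhds hm)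
  refine ⟨e, he, ψ, hm, hψ, ?_⟩
  have := e.continuousAt_symm (e.map_source hm)
  rw [ContinuousAt, e.left_inv hm] at this
  exact this.eventually hψ1

set_option synthInstance.maxHeartbeats 200000 in
/-- A parallel section that vanishes at a point vanishes around it. -/
theorem eventually_eq_zero_of_parallel {X : F.sections} {m : M}
    (hX : ∀ᶠ y in 𝓝 m, C.ParallelAt X y) (h0 : (X : SmoothVF E M) m = 0) :
    ∀ᶠ y in 𝓝 m, (X : SmoothVF E M) y = 0 := by
  obtain ⟨e, he, ψ, hm, hψ, hψ1⟩ := exists_chart_bump F m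
  have hz := e.map_source hm
  have hX' : ∀ᶠ x in 𝓝 (e m), C.ParallelAt X (e.symm x) := by
    have := e.continuousAt_symm hz
    rw [ContinuousAt, e.left_inv hm] at this
    exact this.eventually hX
  set A := C.form he ψ hψ
  have hA := eventually_norm_lt_add_one (f := A) (C.differentiableAt_form he ψ hψ hz).continuousAt
  obtain ⟨ρ, hρ, hball⟩ := Metric.eventually_nhds_iff_ball.1
    ((hX'.and hA).and (hψ1.eventually_nhds.and (e.open_target.mem_nhds hz)))
  have hd : ∀ x ∈ Metric.ball (e m) ρ, ∀ v, fderiv ℝ (sectionRep e X) x v =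
      -A x v (sectionRep e X x) := by
    intro x hx v
    obtain ⟨⟨hpar, -⟩, h1, hxt⟩ := hball x hx
    have h2 := C.sectionRep_cov he hψ (coordField (F.smooth he) ψ hψ v) X hxt h1
    rw [chartRep_coordField _ _ _ _ hxt, h1.self_of_nhds, one_smul] at h2
    have h3 : sectionRep e (C.cov (coordField (F.smooth he) ψ hψ v) X) x = 0 := by
      rw [← sectionRep_zero (F := F) e x]
      exact sectionRep_congr (hpar _)
    rw [h3] at h2
    exact eq_neg_of_add_eq_zero_left h2.symm
  -- Along a ray from `e m` the representation of `X` solves a homogeneous linear equation with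
  -- bounded coefficient and zero initial value, so it vanishes by Gronwall's inequality.
  have hzero : ∀ x ∈ Metric.ball (e m) ρ, sectionRep e X x = 0 := by
    intro x hx
    set y := x - e m with hy
    have hseg : ∀ t ∈ Icc (0 : ℝ) 1, e m + t • y ∈ Metric.ball (e m) ρ := by
      intro t ht
      rw [mem_ball_iff_norm] at hx ⊢
      rw [add_sub_cancel_left, norm_smul, Real.norm_of_nonneg ht.1]
      exact (mul_le_of_le_one_left (norm_nonneg _) ht.2).trans_lt hx
    have hder : ∀ t ∈ Icc (0 : ℝ) 1, HasDerivAt (fun t : ℝ => sectionRep e X (e m + t • y))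
        (-A (e m + t • y) y (sectionRep e X (e m + t • y))) t := by
      intro t ht
      rw [← hd _ (hseg t ht)]
      have h1 : HasDerivAt (fun t : ℝ => e m + t • y) y t := by
        simpa using ((hasDerivAt_id t).smul_const y).const_add (e m)
      exact HasFDerivAt.comp_hasDerivAt (l := sectionRep e X) t (differentiableAt_sectionRep he X
        (hball _ (hseg t ht)).2.2).hasFDerivAt h1
    have hres := eq_zero_of_abs_deriv_le_mul_abs_self_of_eq_zero_right (a := 0) (b := 1)
      (K := (‖A (e m)‖ + 1) * ‖y‖)
      (fun t ht => (hder t ht).continuousAt.continuousWithinAt)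
      (fun t ht => (hder t (Ico_subset_Icc_self ht)).hasDerivWithinAt) ?_ ?_ 1 (by simp)
    · simpa [hy] using hres
    · rw [zero_smul, add_zero, ← sectionRep_zero (F := F) e (e m)]
      refine sectionRep_congr ?_
      rw [e.left_inv hm, h0]
      rfl
    · intro t ht
      rw [norm_neg]
      refine (ContinuousLinearMap.le_opNorm₂ _ _ _).trans ?_
      gcongr
      exact (hball _ (hseg t (Ico_subset_Icc_self ht))).1.2.le
  have hev : ∀ᶠ y in 𝓝 m, e y ∈ Metric.ball (e m) ρ :=
    (e.continuousAt hm).eventually (Metric.ball_mem_nhds _ hρ)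
  filter_upwards [hev, e.open_source.mem_nhds hm] with y hy hys
  have h5 := sectionRep_injective he (e.map_source hys) (X := X) (Y := 0)
    (by rw [hzero _ hy, sectionRep_zero])
  rw [e.left_inv hys] at h5
  exact h5

/-- A flat connection has local parallel frames. -/
theorem exists_local_parallel (hC : C.IsFlat) (m₀ : M) :
    ∃ U : Set M, IsOpen U ∧ m₀ ∈ U ∧ ∃ Φ : F.SliceModel → F.sections,
      (∀ m ∈ U, ∀ u, C.ParallelAt (Φ u) m) ∧
      ∀ m ∈ U, ∀ v ∈ F.tangent m, ∃! u, (Φ u : SmoothVF E M) m = v := by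
  obtain ⟨e, he, ψ, hm, hψ, hψ1⟩ := exists_chart_bump F m₀
  have hz := e.map_source hm
  have : CompleteSpace (F.SliceModel →L[ℝ] F.SliceModel) := FiniteDimensional.complete ℝ _
  obtain ⟨G, hG1, hG⟩ := exists_parallel_of_flat (A := C.form he ψ hψ) (z := e m₀)
    (((C.contDiffOn_form he ψ hψ).contDiffAt (e.open_target.mem_nhds hz)).of_le two_le_smooth) (by
      filter_upwards [hψ1.eventually_nhds, e.open_target.mem_nhds hz] with x hx hxt
      exact C.form_flat he hψ hC hxt hx)
  -- The solution `G` is `1` at the centre and units form an open set, so the sections `G x u` form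
  -- a frame near the centre.
  have hunit : ∀ᶠ x in 𝓝 (e m₀), IsUnit (G x) := by
    have h1 : ContinuousAt G (e m₀) := hG.self_of_nhds.continuousAt
    exact h1.eventually (Units.isOpen.mem_nhds (by rw [mem_ofPred_eq, hG1]; exact isUnit_one))
  obtain ⟨ρ, hρ, hball⟩ := Metric.eventually_nhds_iff_ball.1
    ((hG.and hunit).and (hψ1.eventually_nhds.and (e.open_target.mem_nhds hz)))
  -- So far `G` is only known to be differentiable near the centre; the equation itself makes it
  -- smooth.
  have hGs : ContDiffOn ℝ ∞ G (Metric.ball (e m₀) ρ) :=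
    contDiffOn_of_linear_pde Metric.isOpen_ball
      ((C.contDiffOn_form he ψ hψ).mono fun x hx => (hball x hx).2.2) fun x hx => (hball x hx).1.1
  have hgs (u : F.SliceModel) : ContDiffOn ℝ ∞ (fun x => G x u) (Metric.ball (e m₀) ρ) :=
    hGs.clm_apply contDiffOn_const
  have hB : e.source ∩ e ⁻¹' Metric.ball (e m₀) ρ ∈ 𝓝 m₀ :=
    (e.isOpen_inter_preimage Metric.isOpen_ball).mem_nhds ⟨hm, Metric.mem_ball_self hρ⟩
  obtain ⟨χ, hχ, hχ1⟩ := exists_smooth_bump (E := E) hB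
  obtain ⟨U, hU, hUo, hmU⟩ := eventually_nhds_iff.1 (hχ1.and (eventually_mem_set.2 hB))
  set Φ := fun u => extendSection he hψ Metric.isOpen_ball hχ (hgs u) with hΦ
  have hrep : ∀ m ∈ U, ∀ u, sectionRep e (Φ u) (e m) = G (e m) u := by
    intro m hm u
    obtain ⟨h1, h2, h3⟩ := hU m hm
    obtain ⟨-, h4, h5⟩ := hball _ h3
    exact sectionRep_extendSection he hψ _ hχ _ h5 h4.self_of_nhds (by rwa [e.left_inv h2])
  refine ⟨U, hUo, hmU, Φ, fun m hmU u V => ?_, fun m hmU v hv => ?_⟩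
  · obtain ⟨h1, h2, h3⟩ := hU m hmU
    obtain ⟨⟨h6, -⟩, h4, h5⟩ := hball _ h3
    have h7 : sectionRep e (C.cov V (Φ u)) (e m) = sectionRep e (0 : F.sections) (e m) := by
      rw [C.sectionRep_cov he hψ V _ h5 h4, hrep m hmU, sectionRep_zero]
      have h8 : sectionRep e (Φ u) =ᶠ[𝓝 (e m)] fun x => G x u := by
        have h9 : ∀ᶠ x in 𝓝 (e m), e.symm x ∈ U := by
          have := e.continuousAt_symm h5
          rw [ContinuousAt, e.left_inv h2] at this
          exact this.eventually (hUo.mem_nhds hmU)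
        filter_upwards [h9, e.open_target.mem_nhds h5] with x hx hxt
        have := hrep _ hx u
        rwa [e.right_inv hxt] at this
      rw [h8.fderiv_eq, (h6.clm_apply (hasFDerivAt_const u _)).fderiv]
      simp
    have h10 := sectionRep_injective he h5 h7
    rw [e.left_inv h2] at h10
    exact h10
  · obtain ⟨h1, h2, h3⟩ := hU m hmU
    obtain ⟨⟨h6, h7⟩, h4, h5⟩ := hball _ h3
    obtain ⟨g, hg⟩ := h7
    obtain ⟨w, hw⟩ := exists_sliceIncl_eq (F := F) (hv e he h2)
    have hiff (u : F.SliceModel) : (Φ u : SmoothVF E M) m = v ↔ G (e m) u = w := by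
      rw [← hrep m hmU]
      refine (mfderiv_chart_injective (F.smooth he) h2).eq_iff.symm.trans ?_
      rw [← chartRep_apply_self h2, ← sliceIncl_sectionRep he _ h5]
      exact (congrArg (F.sliceIncl _ = ·) hw.symm).to_iff.trans
        (Function.LeftInverse.injective (g := F.sliceProj) sliceProj_sliceIncl).eq_iff
    simp only [hiff]
    refine ⟨(↑g⁻¹ : F.SliceModel →L[ℝ] F.SliceModel) w, ?_, fun u hu => ?_⟩
    · rw [← hg]
      exact DFunLike.congr_fun g.mul_inv w
    · rw [← hu, ← hg]
      exact (DFunLike.congr_fun g.inv_mul u).symm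

end Connection

end RegularFoliation

/-! ### Discrete bundles over simply connected spaces -/

/-- Locally constant cocycles on simply connected spaces have global sections. -/
theorem exists_section_of_locally_constant_cocycle {M S : Type*} [TopologicalSpace M]
    [SimplyConnectedSpace M] [LocallyPathConnectedSpace M] {U : M → Set M}
    (hU : ∀ i, IsOpen (U i)) (hmem : ∀ i, i ∈ U i) (c : M → M → M → S → S)
    (hself : ∀ i, ∀ x ∈ U i, ∀ v, c i i x v = v)
    (hcomp : ∀ i j k, ∀ x ∈ U i ∩ U j ∩ U k, ∀ v, c j k x (c i j x v) = c i k x v)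
    (hloc : ∀ i j, ∀ x ∈ U i ∩ U j, ∀ v, ∀ᶠ y in 𝓝 x, c i j y v = c i j x v)
    (m₀ : M) (v₀ : S) :
    ∃ s : M → S, s m₀ = v₀ ∧ ∀ i, ∀ x ∈ U i, ∀ᶠ y in 𝓝 x, c y i y (s y) = c x i x (s x) := by
  -- For the discrete topology on the fibre a locally constant cocycle is continuous, and the bundle
  -- it defines is a covering of `M`.
  let _ : TopologicalSpace S := ⊥
  have : DiscreteTopology S := ⟨rfl⟩
  let Z : FiberBundleCore M M S :=
    { baseSet := U
      isOpen_baseSet := hU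
      indexAt := id
      mem_baseSet_at := hmem
      coordChange := c
      coordChange_self := hself
      continuousOn_coordChange := by
        rintro i j ⟨x, v⟩ ⟨hx, -⟩
        have h1 : ∀ᶠ p : M × S in 𝓝 (x, v), c i j p.1 p.2 = c i j x v := by
          have h2 : ∀ᶠ p : M × S in 𝓝 (x, v), c i j p.1 v = c i j x v :=
            (continuous_fst.tendsto (x, v)).eventually (p := fun y => c i j y v = c i j x v)
              (hloc i j x hx v)
          have h3 : ∀ᶠ p : M × S in 𝓝 (x, v), p.2 = v :=
            (continuous_snd.tendsto (x, v)).eventually (p := fun w => w = v) (by rw [nhds_discrete]; exact eventually_pure.2 rfl)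
          filter_upwards [h2, h3] with p hp2 hp3
          rw [hp3, hp2]
        exact ContinuousAt.continuousWithinAt
          (tendsto_nhds_of_eventually_eq h1)
      coordChange_comp := hcomp }
  have hcov : IsCoveringMap (Bundle.TotalSpace.proj : Bundle.TotalSpace S Z.Fiber → M) :=
    FiberBundle.isCoveringMap
  -- A global section is a lift of the identity, which exists because `M` is simply connected and
  -- locally path connected. In a trivialization its fibre coordinate is continuous with discrete
  -- values, so it is locally constant.
  obtain ⟨σ, ⟨hσ0, hσ⟩, -⟩ := hcov.existsUnique_continuousMap_lifts (ContinuousMap.id M) m₀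
    (⟨m₀, v₀⟩ : Bundle.TotalSpace S Z.Fiber) rfl
  have hproj (x : M) : (σ x).1 = x := congrFun hσ x
  refine ⟨fun x => (σ x).2,
    congrArg (fun p : Bundle.TotalSpace S Z.Fiber => (show S from p.2)) hσ0, fun i x hx => ?_⟩
  have hsrc : σ x ∈ (Z.localTriv i).source := by
    rw [Z.mem_localTriv_source, ← Z.baseSet_at, hproj]
    exact hx
  have hcont : ContinuousAt (fun y => (Z.localTriv i (σ y)).2) x :=
    continuousAt_snd.comp (((Z.localTriv i).continuousAt hsrc).comp σ.continuous.continuousAt)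
  have hev : ∀ᶠ y in 𝓝 x, (Z.localTriv i (σ y)).2 = (Z.localTriv i (σ x)).2 :=
    hcont.eventually (p := (· = (Z.localTriv i (σ x)).2))
      (by rw [nhds_discrete]; exact eventually_pure.2 rfl)
  have hval (y : M) : (Z.localTriv i (σ y)).2 = c y i y (σ y).2 := by
    rw [Z.localTriv_apply]
    change c (σ y).1 i (σ y).1 (σ y).2 = _
    rw [hproj]
  filter_upwards [hev] with y hy
  rw [← hval, hy, hval]

/-- A finite-dimensional Lie algebra is isomorphic to one on a coordinate space. -/
theorem exists_lieEquiv_type (𝔭 : Type*) [LieRing 𝔭] [LieAlgebra ℝ 𝔭] [FiniteDimensional ℝ 𝔭] :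
    ∃ (𝔤 : Type) (_ : LieRing 𝔤) (_ : LieAlgebra ℝ 𝔤) (_ : FiniteDimensional ℝ 𝔤),
      Nonempty (𝔤 ≃ₗ⁅ℝ⁆ 𝔭) := by
  let L : (Fin (Module.finrank ℝ 𝔭) → ℝ) ≃ₗ[ℝ] 𝔭 := (Module.finBasis ℝ 𝔭).equivFun.symm
  let _ : LieRing (Fin (Module.finrank ℝ 𝔭) → ℝ) :=
    { (inferInstance : AddCommGroup (Fin (Module.finrank ℝ 𝔭) → ℝ)) with
      bracket := fun x y => L.symm ⁅L x, L y⁆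
      add_lie := fun x y z => by
        change L.symm ⁅L (x + y), L z⁆ = L.symm ⁅L x, L z⁆ + L.symm ⁅L y, L z⁆
        rw [map_add, add_lie, map_add]
      lie_add := fun x y z => by
        change L.symm ⁅L x, L (y + z)⁆ = L.symm ⁅L x, L y⁆ + L.symm ⁅L x, L z⁆
        rw [map_add, lie_add, map_add]
      lie_self := fun x => by
        change L.symm ⁅L x, L x⁆ = 0
        rw [lie_self, map_zero]
      leibniz_lie := fun x y z => by
        change L.symm ⁅L x, L (L.symm ⁅L y, L z⁆)⁆ =
          L.symm ⁅L (L.symm ⁅L x, L y⁆), L z⁆ + L.symm ⁅L y, L (L.symm ⁅L x, L z⁆)⁆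
        simp only [LinearEquiv.apply_symm_apply]
        rw [leibniz_lie, map_add] }
  let _ : LieAlgebra ℝ (Fin (Module.finrank ℝ 𝔭) → ℝ) :=
    { (inferInstance : Module ℝ (Fin (Module.finrank ℝ 𝔭) → ℝ)) with
      lie_smul := fun t x y => by
        change L.symm ⁅L x, L (t • y)⁆ = t • L.symm ⁅L x, L y⁆
        rw [map_smul, lie_smul, map_smul] }
  refine ⟨Fin (Module.finrank ℝ 𝔭) → ℝ, inferInstance, inferInstance,
    inferInstanceAs (Module.Finite ℝ (Fin (Module.finrank ℝ 𝔭) → ℝ)), ⟨{ L with map_lie' := ?_ }⟩⟩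
  intro x y
  exact L.apply_symm_apply ⁅L x, L y⁆

/-! ### Global parallel sections and their Lie algebra -/

namespace RegularFoliation

variable {E : Type*} [NormedAddCommGroup E] [NormedSpace ℝ E] [FiniteDimensional ℝ E]
  {M : Type*} [TopologicalSpace M] [ChartedSpace E M] [IsManifold 𝓘(ℝ, E) ∞ M]
  {F : RegularFoliation E M}

namespace Connection

variable (C : F.Connection) [T2Space M]

/-- A flat connection on a simply connected manifold has global parallel sections with given values
at a point. -/
theorem exists_global_parallel [SimplyConnectedSpace M] (hC : C.IsFlat) (m₀ : M)
    {v₀ : TangentSpace 𝓘(ℝ, E) m₀} (hv₀ : v₀ ∈ F.tangent m₀) :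
    ∃ X : F.sections, (X : SmoothVF E M) m₀ = v₀ ∧ ∀ m, C.ParallelAt X m := by
  classical
  have : LocallyPathConnectedSpace M := ChartedSpace.locallyPathConnectedSpace E M
  choose U hUo hmU Φ hpar hex using C.exists_local_parallel hC
  -- The coordinates of the vector `w` in the parallel frame `Φ j` at `x`. The default value `0` is
  -- irrelevant: `κ` is only evaluated meaningfully for `x ∈ U j` and tangent `w`, where the
  -- coordinates exist.
  let κ (j x : M) (w : TangentSpace 𝓘(ℝ, E) x) : F.SliceModel :=
    if h : ∃ u, (Φ j u : SmoothVF E M) x = w then h.choose else 0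
  have hκ {j x : M} (hx : x ∈ U j) {w : TangentSpace 𝓘(ℝ, E) x} (hw : w ∈ F.tangent x) :
      (Φ j (κ j x w) : SmoothVF E M) x = w := by
    have h := (hex j x hx w hw).exists
    simp only [κ, dif_pos h]
    exact h.choose_spec
  have hκ' {j x : M} (hx : x ∈ U j) (u : F.SliceModel) : κ j x ((Φ j u : SmoothVF E M) x) = u :=
    (hex j x hx _ ((Φ j u).2 x)).unique (hκ hx ((Φ j u).2 x)) rfl
  obtain ⟨u₀, hu₀, -⟩ := hex m₀ m₀ (hmU m₀) v₀ hv₀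
  obtain ⟨s, hs0, hs⟩ := exists_section_of_locally_constant_cocycle hUo hmU
    (fun i j x v => κ j x ((Φ i v : SmoothVF E M) x)) (fun i x hx v => hκ' hx v)
    (fun i j k x hx v => by
      rw [hκ hx.1.2 ((Φ i v).2 x)])
    (fun i j x hx v => by
      set u := κ j x ((Φ i v : SmoothVF E M) x) with hu
      -- The transition is locally constant because two parallel sections that agree at `x` agree
      -- near `x`.
      have hev : ∀ᶠ y in 𝓝 x, ((Φ i v - Φ j u : F.sections) : SmoothVF E M) y = 0 := by
        refine C.eventually_eq_zero_of_parallel ?_ ?_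
        · filter_upwards [(hUo i).mem_nhds hx.1, (hUo j).mem_nhds hx.2] with y hyi hyj
          exact C.parallelAt_sub (hpar i y hyi v) (hpar j y hyj u)
        · exact sub_eq_zero.2 (hκ hx.2 ((Φ i v).2 x)).symm
      filter_upwards [hev, (hUo j).mem_nhds hx.2] with y hy hyj
      have h1 : (Φ i v : SmoothVF E M) y = (Φ j u : SmoothVF E M) y := sub_eq_zero.1 hy
      rw [h1, hκ' hyj])
    m₀ u₀
  -- The value of `s` at `y` refers to the frame indexed by `y`. Translated into the frame indexed
  -- by `x` it is constant for `y` near `x`, so the glued field coincides locally with one parallel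
  -- section and inherits smoothness and parallelism.
  have hloc (x : M) : ∀ᶠ y in 𝓝 x,
      (Φ y (s y) : SmoothVF E M) y = (Φ x (s x) : SmoothVF E M) y := by
    filter_upwards [hs x x (hmU x), (hUo x).mem_nhds (hmU x)] with y hy hyx
    have h1 := hκ hyx ((Φ y (s y)).2 y)
    rw [hy, hκ' (hmU x)] at h1
    exact h1.symm
  let X : F.sections := ⟨⟨fun y => (Φ y (s y) : SmoothVF E M) y, fun x => by
    refine ((Φ x (s x) : SmoothVF E M).contMDiff x).congr_of_eventuallyEq ?_
    filter_upwards [hloc x] with y hy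
    rw [hy]⟩, fun m => (Φ m (s m)).2 m⟩
  refine ⟨X, ?_, fun m => ?_⟩
  · change (Φ m₀ (s m₀) : SmoothVF E M) m₀ = v₀
    rw [hs0, hu₀]
  · exact C.parallelAt_congr ((hloc m).mono fun y hy => hy.symm) (hpar m m (hmU m) (s m))

/-- The zero set is open by local uniqueness of parallel sections and closed by continuity in
charts, hence everything on a connected manifold. -/
theorem eq_zero_of_parallel [PreconnectedSpace M] {X : F.sections} (hX : ∀ m, C.ParallelAt X m)
    {m₀ : M} (h0 : (X : SmoothVF E M) m₀ = 0) (m : M) : (X : SmoothVF E M) m = 0 := by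
  have hclopen : IsClopen {m | (X : SmoothVF E M) m = 0} := by
    refine ⟨⟨isOpen_iff_mem_nhds.2 fun m hm => ?_⟩, isOpen_iff_mem_nhds.2 fun m hm =>
      C.eventually_eq_zero_of_parallel (Eventually.of_forall hX) hm⟩
    obtain ⟨e, he, hme⟩ := F.cover m
    have hz := e.map_source hme
    have hne : chartRep e X (e m) ≠ 0 := by
      rw [← chartRep_zero e (e m)]
      exact fun h => hm (chartRep_injective (F.smooth he) hme h)
    have hcont : ContinuousAt (fun y => chartRep e X (e y)) m :=
      ContinuousAt.comp (g := chartRep e (X : SmoothVF E M)) (f := e)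
        (differentiableAt_chartRep (F.smooth he) _ hz).continuousAt (e.continuousAt hme)
    filter_upwards [hcont.eventually_ne hne, e.open_source.mem_nhds hme] with y hy hys h
    refine hy ?_
    rw [chartRep_apply_self hys, h]
    exact map_zero (mfderiv 𝓘(ℝ, E) 𝓘(ℝ, E) e y)
  have : m ∈ {m | (X : SmoothVF E M) m = 0} := by
    rw [hclopen.eq_univ ⟨m₀, h0⟩]
    trivial
  exact this

variable {C}

/-- The Lie algebra of parallel sections. -/
def parallelSections (hbar : C.BarIsFlat) : LieSubalgebra ℝ (SmoothVF E M) where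
  carrier := {X | ∃ h : X ∈ F.sections, ∀ V, C.cov V ⟨X, h⟩ = 0}
  add_mem' := by
    rintro X Y ⟨hX, hX'⟩ ⟨hY, hY'⟩
    refine ⟨F.sections.add_mem hX hY, fun V => ?_⟩
    have := C.add_right V ⟨X, hX⟩ ⟨Y, hY⟩
    rw [hX', hY', add_zero] at this
    exact this
  zero_mem' := ⟨F.sections.zero_mem, fun V => C.cov_zero_right V⟩
  smul_mem' := by
    rintro c X ⟨hX, hX'⟩
    refine ⟨F.sections.smul_mem c hX, fun V => ?_⟩
    have := C.cov_const_smul_right V c ⟨X, hX⟩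
    rw [hX', smul_zero] at this
    exact this
  lie_mem' := by
    rintro X Y ⟨hX, hX'⟩ ⟨hY, hY'⟩
    refine ⟨F.sections.lie_mem hX hY, fun V => ?_⟩
    -- On parallel sections `∇̄_X` is the bracket with `X`. By the Jacobi identity all double
    -- brackets cancel in the curvature, and what remains is `-∇_V [X, Y]`.
    have h := hbar ⟨X, hX⟩ ⟨Y, hY⟩ V
    have h1 (W : SmoothVF E M) : C.bar ⟨X, hX⟩ W = ⁅X, W⁆ := by
      unfold bar
      rw [hX' W]
      exact zero_add _
    have h2 (W : SmoothVF E M) : C.bar ⟨Y, hY⟩ W = ⁅Y, W⁆ := by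
      unfold bar
      rw [hY' W]
      exact zero_add _
    rw [h1, h2, h1, h2, leibniz_lie] at h
    have h3 : C.bar ⁅(⟨X, hX⟩ : F.sections), ⟨Y, hY⟩⁆ V =
        (C.cov V ⟨⁅X, Y⁆, F.sections.lie_mem hX hY⟩ : SmoothVF E M) + ⁅⁅X, Y⁆, V⁆ := rfl
    rw [h3] at h
    apply Subtype.ext
    change (C.cov V ⟨⁅X, Y⁆, F.sections.lie_mem hX hY⟩ : SmoothVF E M) = 0
    rw [← neg_eq_zero, ← h]
    abel

end Connection

end RegularFoliation

/-! ### Smooth dependence of coefficients with respect to a frame -/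

/-- The solution of a linear equation with injective coefficients depends smoothly on the
parameters. -/
theorem contDiffAt_of_clm_apply_eq {X G E : Type*} [NormedAddCommGroup X] [NormedSpace ℝ X]
    [NormedAddCommGroup G] [NormedSpace ℝ G] [FiniteDimensional ℝ G] [NormedAddCommGroup E]
    [NormedSpace ℝ E] [FiniteDimensional ℝ E] {n : WithTop ℕ∞} {T : X → G →L[ℝ] E} {y : X → E}
    {c : X → G} {x₀ : X} (hT : ContDiffAt ℝ n T x₀) (hy : ContDiffAt ℝ n y x₀)
    (hc : ∀ᶠ x in 𝓝 x₀, T x (c x) = y x) (hinj : Function.Injective (T x₀)) :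
    ContDiffAt ℝ n c x₀ := by
  have : CompleteSpace G := FiniteDimensional.complete ℝ G
  -- With a fixed left inverse `S` of `T x₀`, the endomorphism `S ∘ T x` is invertible for `x` near
  -- `x₀`, so `c = (S ∘ T)⁻¹ S y`; inversion is smooth at units.
  obtain ⟨g, hg⟩ := LinearMap.exists_leftInverse_of_injective (T x₀ : G →ₗ[ℝ] E)
    (LinearMap.ker_eq_bot.2 hinj)
  set S : E →L[ℝ] G := LinearMap.toContinuousLinearMap g
  have hS : S.comp (T x₀) = 1 := by
    ext u
    exact LinearMap.congr_fun hg u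
  have hST : ContDiffAt ℝ n (fun x => S.comp (T x)) x₀ := contDiffAt_const.clm_comp hT
  have hunit : ∀ᶠ x in 𝓝 x₀, IsUnit (S.comp (T x)) :=
    hST.continuousAt.eventually (Units.isOpen.mem_nhds
      (show IsUnit (S.comp (T x₀)) by rw [hS]; exact isUnit_one))
  have hinv : ContDiffAt ℝ n (fun x => Ring.inverse (S.comp (T x))) x₀ := by
    have h1 := contDiffAt_ringInverse ℝ (n := n) (1 : (G →L[ℝ] G)ˣ)
    have h2 : ((1 : (G →L[ℝ] G)ˣ) : G →L[ℝ] G) = S.comp (T x₀) := by rw [hS]; rfl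
    rw [h2] at h1
    exact h1.comp x₀ hST
  refine (hinv.clm_apply (contDiffAt_const.clm_apply hy : ContDiffAt ℝ n (fun x => S (y x)) x₀)
    ).congr_of_eventuallyEq ?_
  filter_upwards [hc, hunit] with x hx hu
  rw [← hx]
  exact (DFunLike.congr_fun (Ring.inverse_mul_cancel _ hu) (c x)).symm

section Frames

variable {E : Type*} [NormedAddCommGroup E] [NormedSpace ℝ E] [FiniteDimensional ℝ E]
  {M : Type*} [TopologicalSpace M] [ChartedSpace E M] [IsManifold 𝓘(ℝ, E) ∞ M]

/-- The coordinate expression of the combinations of finitely many vector fields. -/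
def frameRep {n : ℕ} (e : OpenPartialHomeomorph M E) (X : Fin n → SmoothVF E M) (x : E) :
    (Fin n → ℝ) →L[ℝ] E :=
  ∑ i, (ContinuousLinearMap.proj (R := ℝ) (φ := fun _ : Fin n => ℝ) i).smulRight
    (chartRep e (X i) x)

theorem frameRep_apply {n : ℕ} (e : OpenPartialHomeomorph M E) (X : Fin n → SmoothVF E M) (x : E)
    (c : Fin n → ℝ) : frameRep e X x c = ∑ i, c i • chartRep e (X i) x := by
  simp [frameRep]

theorem frameRep_eq_mfderiv {n : ℕ} {e : OpenPartialHomeomorph M E} {m : M} (hm : m ∈ e.source)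
    (X : Fin n → SmoothVF E M) (c : Fin n → ℝ) :
    frameRep e X (e m) c = mfderiv 𝓘(ℝ, E) 𝓘(ℝ, E) e m (∑ i, c i • X i m) := by
  rw [frameRep_apply, map_sum]
  refine Finset.sum_congr rfl fun i _ => ?_
  rw [map_smul, chartRep_apply_self hm]
  rfl

/-- The coefficients with respect to a frame of a smooth field are smooth. -/
theorem contDiffAt_frame_coeff {n : ℕ} {e : OpenPartialHomeomorph M E}
    (he : e ∈ IsManifold.maximalAtlas 𝓘(ℝ, E) ∞ M) {X : Fin n → SmoothVF E M}
    (hX : ∀ m (c : Fin n → ℝ), ∑ i, c i • X i m = 0 → c = 0) {y : E → E} {c : E → Fin n → ℝ}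
    {x : E} (hx : x ∈ e.target) (hy : ContDiffAt ℝ ∞ y x)
    (hc : ∀ᶠ x in 𝓝 x, frameRep e X x (c x) = y x) : ContDiffAt ℝ ∞ c x := by
  refine contDiffAt_of_clm_apply_eq (T := frameRep e X) ?_ hy hc ?_
  · unfold frameRep
    exact ContDiffAt.sum fun i _ => contDiffAt_const.smulRight (contDiffAt_chartRep he (X i) hx)
  · refine (injective_iff_map_eq_zero _).2 fun c hc0 => hX (e.symm x) c ?_
    rw [← e.right_inv hx, frameRep_eq_mfderiv (e.map_target hx)] at hc0
    refine mfderiv_chart_injective he (e.map_target hx) (hc0.trans ?_)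
    exact (map_zero (mfderiv 𝓘(ℝ, E) 𝓘(ℝ, E) e (e.symm x))).symm

end Frames

theorem eqvGen_of_forall {α : Type*} {r s : α → α → Prop}
    (h : ∀ a b, r a b → Relation.EqvGen s a b) {a b : α} (hab : Relation.EqvGen r a b) :
    Relation.EqvGen s a b := by
  induction hab with
  | rel a b hr => exact h a b hr
  | refl a => exact .refl a
  | symm a b _ ih => exact .symm _ _ ih
  | trans a b c _ _ ih1 ih2 => exact .trans _ _ _ ih1 ih2

theorem hasDerivWithinAt_comp_chart {E : Type*} [NormedAddCommGroup E] [NormedSpace ℝ E]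
    {M : Type*} [TopologicalSpace M] [ChartedSpace E M] {e : M → E} {γ : ℝ → M} {s : Set ℝ} {t : ℝ}
    {v : TangentSpace 𝓘(ℝ, E) (γ t)} {w : E}
    (hγ : HasMFDerivWithinAt 𝓘(ℝ, ℝ) 𝓘(ℝ, E) γ s t ((1 : ℝ →L[ℝ] ℝ).smulRight v))
    (he : MDifferentiableAt 𝓘(ℝ, E) 𝓘(ℝ, E) e (γ t))
    (hw : w = mfderiv 𝓘(ℝ, E) 𝓘(ℝ, E) e (γ t) v) : HasDerivWithinAt (e ∘ γ) w s t := by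
  have h1 : HasMFDerivWithinAt 𝓘(ℝ, ℝ) 𝓘(ℝ, E) (e ∘ γ) s t ((1 : ℝ →L[ℝ] ℝ).smulRight w) := by
    refine (he.hasMFDerivAt.comp_hasMFDerivWithinAt t hγ).congr_mfderiv ?_
    rw [hw]
    ext
    exact map_smul (mfderiv 𝓘(ℝ, E) 𝓘(ℝ, E) e (γ t)) _ _
  have h2 : HasFDerivWithinAt (e ∘ γ) ((1 : ℝ →L[ℝ] ℝ).smulRight w) s t := h1.hasFDerivWithinAt
  simpa using h2.hasDerivWithinAt

/-! ### Orbits and leaves -/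

namespace LieAlgAction

variable {E : Type*} [NormedAddCommGroup E] [NormedSpace ℝ E] [FiniteDimensional ℝ E]
  {M : Type*} [TopologicalSpace M] [ChartedSpace E M] [IsManifold 𝓘(ℝ, E) ∞ M]
  {𝔤 : Type*} [LieRing 𝔤] [LieAlgebra ℝ 𝔤] {F : RegularFoliation E M}
  {A : LieAlgAction 𝔤 E M}

/-- Paths along an action tangent to the foliation stay in a leaf. -/
theorem eqvGen_samePlaque_of_reaches (hA : ∀ ξ m, A ξ m ∈ F.tangent m) {x y : M}
    (h : A.Reaches x y) : Relation.EqvGen F.SamePlaque x y := by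
  obtain ⟨γ, ξ, rfl, rfl, -, hγ⟩ := h
  -- An equivalence relation on an interval that relates each point to all nearby ones relates the
  -- endpoints, so it suffices to work in one foliated chart around `γ s`.
  refine isPreconnected_Icc.induction₂ (s := Icc (0 : ℝ) 1)
    (fun s t => Relation.EqvGen F.SamePlaque (γ s) (γ t)) (fun s hs => ?_)
    (fun a b c _ _ _ h1 h2 => .trans _ _ _ h1 h2) (fun a b _ _ h => .symm _ _ h)
    (left_mem_Icc.2 zero_le_one) (right_mem_Icc.2 zero_le_one)
  obtain ⟨e, he, hse⟩ := F.cover (γ s)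
  have hd := mdifferentiable_of_mem_maximalAtlas (F.smooth he)
  have hsrc : ∀ᶠ t in 𝓝[Icc 0 1] s, γ t ∈ e.source :=
    (hγ s hs).1.eventually (e.open_source.mem_nhds hse)
  obtain ⟨r, hr, hrs⟩ := Metric.mem_nhdsWithin_iff.1 hsrc
  set J := Metric.ball s r ∩ Icc 0 1 with hJ
  have hJc : Convex ℝ J := (convex_ball s r).inter (convex_Icc 0 1)
  have hsJ : s ∈ J := ⟨Metric.mem_ball_self hr, hs⟩
  have hder : ∀ t ∈ J, HasDerivWithinAt (e ∘ γ)
      (mfderiv 𝓘(ℝ, E) 𝓘(ℝ, E) e (γ t) (A (ξ t) (γ t)) : E) J t :=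
    fun t ht => (hasDerivWithinAt_comp_chart (hγ t ht.2) (hd.mdifferentiableAt (hrs ht)) rfl).mono
      inter_subset_right
  have hcont : ContinuousOn (e ∘ γ) J := fun t ht => (hder t ht).continuousWithinAt
  -- A linear map with kernel the slice direction. It annihilates the velocity of the path in the
  -- chart, so the path stays in one slice.
  set q : E →L[ℝ] E := ContinuousLinearMap.id ℝ E - F.sliceIncl.comp F.sliceProj with hq
  have hqs : ∀ v ∈ F.slice, q v = 0 := fun v hv => by
    simp [hq, RegularFoliation.sliceIncl_sliceProj hv]
  have hqs' : ∀ v, q v = 0 → v ∈ F.slice := fun v hv => by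
    have : v = F.sliceIncl (F.sliceProj v) := sub_eq_zero.1 hv
    rw [this]
    exact RegularFoliation.sliceIncl_mem _
  have hconst : ∀ t ∈ J, (e ∘ γ) t - (e ∘ γ) s ∈ F.slice := by
    intro t ht
    refine hqs' _ ?_
    have h1 : ∀ t ∈ J, HasDerivWithinAt (fun t => q ((e ∘ γ) t)) 0 J t := by
      intro t ht
      have h2 := HasFDerivAt.comp_hasDerivWithinAt (f := e ∘ γ) t q.hasFDerivAt (hder t ht)
      rw [hqs _ (hA (ξ t) (γ t) e he (hrs ht))] at h2
      exact h2
    have h3 := hJc.norm_image_sub_le_of_norm_hasDerivWithin_le (C := 0) h1 (by simp) hsJ ht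
    rw [zero_mul, norm_le_zero_iff, ← map_sub] at h3
    exact h3
  have hpc : IsPathConnected ((e ∘ γ) '' J) := (hJc.isPathConnected ⟨s, hsJ⟩).image' hcont
  filter_upwards [inter_mem_nhdsWithin _ (Metric.ball_mem_nhds s hr)] with t ht
  have htJ : t ∈ J := ⟨ht.2, ht.1⟩
  refine .rel _ _ ⟨e, he, hse, hrs htJ, ?_⟩
  refine (hpc.joinedIn _ (mem_image_of_mem _ hsJ) _ (mem_image_of_mem _ htJ)).mono ?_
  rintro _ ⟨t', ht', rfl⟩
  exact ⟨e.map_source (hrs ht'), hconst t' ht'⟩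

/-- Points of a plaque can be joined along an action that spans the tangent spaces. -/
theorem eqvGen_reaches_of_samePlaque [FiniteDimensional ℝ 𝔤] (hinj : ∀ ξ m, A ξ m = 0 → ξ = 0)
    (hspan : ∀ m, ∀ v ∈ F.tangent m, ∃ ξ, A ξ m = v) {x y : M} (h : F.SamePlaque x y) :
    Relation.EqvGen A.Reaches x y := by
  obtain ⟨e, he, hx, hy, p, hp⟩ := h
  have hd := mdifferentiable_of_mem_maximalAtlas (F.smooth he)
  set b := Module.finBasis ℝ 𝔤
  have hA (c : Fin (Module.finrank ℝ 𝔤) → ℝ) (m : M) :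
      A (∑ i, c i • b i) m = ∑ i, c i • A (b i) m := by
    rw [map_sum]
    have h1 : ∀ s : Finset (Fin (Module.finrank ℝ 𝔤)), (∑ i ∈ s, A (c i • b i)) m
        = ∑ i ∈ s, c i • A (b i) m := by
      intro s
      induction s using Finset.induction_on with
      | empty => rfl
      | insert i s hi ih =>
        rw [Finset.sum_insert hi, Finset.sum_insert hi, ← ih, map_smul]
        rfl
    exact h1 _
  have hframe : ∀ m (c : Fin (Module.finrank ℝ 𝔤) → ℝ), ∑ i, c i • A (b i) m = 0 → c = 0 := by
    intro m c hc
    rw [← hA] at hc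
    have := hinj _ _ hc
    funext i
    exact Fintype.linearIndependent_iff.1 b.linearIndependent c this i
  -- The path in the plaque is only continuous and cannot itself be followed by the action. Nearby
  -- points of a slice are joined instead by a straight segment in the chart.
  have hlocal : ∀ w ∈ e.target, ∀ᶠ w' in 𝓝 w, w' - w ∈ F.slice →
      A.Reaches (e.symm w) (e.symm w') := by
    intro w hw
    obtain ⟨r, hr, hrt⟩ := Metric.isOpen_iff.1 e.open_target w hw
    filter_upwards [Metric.ball_mem_nhds w hr] with w' hw' hsl
    set u := w' - w with hu
    have hseg : ∀ t ∈ Icc (0 : ℝ) 1, w + t • u ∈ e.target := by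
      intro t ht
      refine hrt ?_
      rw [mem_ball_iff_norm] at hw' ⊢
      rw [add_sub_cancel_left, norm_smul, Real.norm_of_nonneg ht.1]
      exact (mul_le_of_le_one_left (norm_nonneg _) ht.2).trans_lt hw'
    -- The coefficients in the frame of the constant field `u`. The arbitrary value off the target
    -- makes them a function on all of `E`; on the target they are smooth, so the control `ξ` along
    -- the segment is continuous.
    have hex : ∀ z, ∃ c : Fin (Module.finrank ℝ 𝔤) → ℝ, z ∈ e.target →
        frameRep e (fun i => A (b i)) z c = u := by
      intro z
      by_cases hz : z ∈ e.target
      · have hms := e.map_target hz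
        have hcs : mfderiv 𝓘(ℝ, E) 𝓘(ℝ, E) e (e.symm z)
            (mfderiv 𝓘(ℝ, E) 𝓘(ℝ, E) e.symm z u) = u :=
          DFunLike.congr_fun (hd.comp_symm_deriv hz) u
        obtain ⟨ξ, hξ⟩ := hspan (e.symm z) (mfderiv 𝓘(ℝ, E) 𝓘(ℝ, E) e.symm z u)
          ((RegularFoliation.mem_tangent_iff he hms).2
            ((congrArg (· ∈ F.slice) hcs).mpr hsl))
        refine ⟨fun i => b.repr ξ i, fun _ => ?_⟩
        have h1 := frameRep_eq_mfderiv hms (fun i => A (b i)) (fun i => b.repr ξ i)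
        rw [e.right_inv hz] at h1
        rw [h1, ← hA, b.sum_repr, hξ]
        exact hcs
      · exact ⟨0, fun h => absurd h hz⟩
    choose c hc using hex
    have hcs : ∀ z ∈ e.target, ContDiffAt ℝ ∞ c z := fun z hz =>
      contDiffAt_frame_coeff (F.smooth he) hframe hz contDiffAt_const
        (by filter_upwards [e.open_target.mem_nhds hz] with z' hz' using hc z' hz')
    refine ⟨fun t => e.symm (w + t • u), fun t => ∑ i, c (w + t • u) i • b i, by simp,
      by simp [hu], fun φ t ht => ?_, fun t ht => ?_⟩
    · have h1 : ContinuousAt c (w + t • u) := (hcs _ (hseg t ht)).continuousAt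
      have h2 : ContinuousAt (fun t : ℝ => c (w + t • u)) t :=
        ContinuousAt.comp (g := c) (f := fun t : ℝ => w + t • u) h1
          (by fun_prop : Continuous fun t : ℝ => w + t • u).continuousAt
      have h3 : ContinuousAt (fun t : ℝ => ∑ i, c (w + t • u) i * φ (b i)) t :=
        tendsto_finsetSum _ fun i _ => ((continuousAt_pi.1 h2 i).mul continuousAt_const)
      refine ContinuousAt.continuousWithinAt ?_
      simpa only [map_sum, map_smul, smul_eq_mul] using h3
    · have hzt := hseg t ht
      have hms := e.map_target hzt
      have h1 : HasMFDerivWithinAt 𝓘(ℝ, ℝ) 𝓘(ℝ, E) (fun t : ℝ => w + t • u) (Icc 0 1) t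
          ((1 : ℝ →L[ℝ] ℝ).smulRight u) := by
        refine HasFDerivWithinAt.hasMFDerivWithinAt ?_
        have : HasDerivAt (fun t : ℝ => w + t • u) u t := by
          simpa using ((hasDerivAt_id t).smul_const u).const_add w
        exact this.hasFDerivAt.hasFDerivWithinAt
      have h2 := (hd.mdifferentiableAt_symm hzt).hasMFDerivAt.comp_hasMFDerivWithinAt t h1
      have h3 : A (∑ i, c (w + t • u) i • b i) (e.symm (w + t • u)) = mfderiv 𝓘(ℝ, E) 𝓘(ℝ, E) e.symm (w + t • u) u := by
        refine mfderiv_chart_injective (F.smooth he) hms ?_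
        have h4 := frameRep_eq_mfderiv hms (fun i => A (b i)) (c (w + t • u))
        rw [e.right_inv hzt, hc _ hzt] at h4
        rw [hA]
        exact h4.symm.trans (DFunLike.congr_fun (hd.comp_symm_deriv hzt) u).symm
      rw [h3]
      refine h2.congr_mfderiv ?_
      ext
      exact map_smul (mfderiv 𝓘(ℝ, E) 𝓘(ℝ, E) e.symm (w + t • u)) _ _
  -- Connectedness of the path's image combines the local segments into a finite chain.
  have hpre : IsPreconnected (range p) := isPreconnected_range p.continuous
  have key := hpre.induction₂ (fun w w' => Relation.EqvGen A.Reaches (e.symm w) (e.symm w'))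
    (fun w hw => ?_) (fun a b c _ _ _ h1 h2 => .trans _ _ _ h1 h2) (fun a b _ _ h => .symm _ _ h)
    ⟨0, p.source⟩ ⟨1, p.target⟩
  · rwa [e.left_inv hx, e.left_inv hy] at key
  · obtain ⟨t, rfl⟩ := hw
    filter_upwards [nhdsWithin_le_nhds (hlocal _ (hp t).1), self_mem_nhdsWithin] with w' hw' hwr
    obtain ⟨t', rfl⟩ := hwr
    refine .rel _ _ (hw' ?_)
    have := F.slice.sub_mem (hp t').2 (hp t).2
    rwa [sub_sub_sub_cancel_right] at this

/-- Orbit and leaf are classes of generated equivalence relations, and each generating relation is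
contained in the equivalence generated by the other. -/
theorem orbit_eq_leaf [FiniteDimensional ℝ 𝔤] (hinj : ∀ ξ m, A ξ m = 0 → ξ = 0)
    (hA : ∀ ξ m, A ξ m ∈ F.tangent m) (hspan : ∀ m, ∀ v ∈ F.tangent m, ∃ ξ, A ξ m = v) (m : M) :
    A.orbit m = F.leaf m := by
  ext y
  exact ⟨eqvGen_of_forall fun _ _ => eqvGen_samePlaque_of_reaches hA,
    eqvGen_of_forall fun _ _ => eqvGen_reaches_of_samePlaque hinj hspan⟩

end LieAlgAction

/-! ### Rules for derivatives of functions along fields -/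

section DirDeriv

variable {E : Type*} [NormedAddCommGroup E] [NormedSpace ℝ E] [FiniteDimensional ℝ E]
  {M : Type*} [TopologicalSpace M] [ChartedSpace E M] [IsManifold 𝓘(ℝ, E) ∞ M]

theorem SmoothFn.dirDeriv_add_right (f : SmoothFn E M) (V W : SmoothVF E M) (m : M) :
    f.dirDeriv (V + W) m = f.dirDeriv V m + f.dirDeriv W m :=
  map_add (mfderiv 𝓘(ℝ, E) 𝓘(ℝ, ℝ) f m) _ _

theorem SmoothFn.dirDeriv_smulFn_right (f g : SmoothFn E M) (V : SmoothVF E M) (m : M) :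
    f.dirDeriv (g • V) m = g m * f.dirDeriv V m :=
  map_smul (mfderiv 𝓘(ℝ, E) 𝓘(ℝ, ℝ) f m) _ _

/-- The same chart, point and vector serve all functions `f`, so the sum and product rules reduce to
those of `fderiv`. -/
theorem SmoothFn.exists_dirDeriv_eq (V : SmoothVF E M) (m : M) :
    ∃ (e : OpenPartialHomeomorph M E) (x v : E), e.symm x = m ∧ ∀ f : SmoothFn E M,
      DifferentiableAt ℝ (f ∘ e.symm) x ∧ f.dirDeriv V m = fderiv ℝ (f ∘ e.symm) x v := by
  have he := IsManifold.chart_mem_maximalAtlas (I := 𝓘(ℝ, E)) (n := ∞) m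
  set e := chartAt E m
  have hm : m ∈ e.source := mem_chart_source E m
  have hx := e.map_source hm
  refine ⟨e, e m, chartRep e V (e m), e.left_inv hm, fun f => ⟨?_, ?_⟩⟩
  · exact ((contDiffOn_comp_chart_symm he f).contDiffAt
      (e.open_target.mem_nhds hx)).differentiableAt (by simp)
  · have := f.dirDeriv_eq_fderiv he V hx
    rwa [e.left_inv hm] at this

theorem SmoothFn.dirDeriv_add_left (f g : SmoothFn E M) (V : SmoothVF E M) (m : M) :
    (f + g).dirDeriv V m = f.dirDeriv V m + g.dirDeriv V m := by
  obtain ⟨e, x, v, -, h⟩ := SmoothFn.exists_dirDeriv_eq V m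
  have h1 : ⇑(f + g) ∘ e.symm = (f ∘ e.symm) + (g ∘ e.symm) := rfl
  rw [(h _).2, (h f).2, (h g).2, h1, fderiv_add (h f).1 (h g).1]
  rfl

theorem SmoothFn.dirDeriv_mul_left (f g : SmoothFn E M) (V : SmoothVF E M) (m : M) :
    (f * g).dirDeriv V m = f m * g.dirDeriv V m + f.dirDeriv V m * g m := by
  obtain ⟨e, x, v, hx, h⟩ := SmoothFn.exists_dirDeriv_eq V m
  have h1 : ⇑(f * g) ∘ e.symm = (f ∘ e.symm) * (g ∘ e.symm) := rfl
  rw [(h _).2, (h f).2, (h g).2, h1, fderiv_mul (h f).1 (h g).1]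
  simp [hx, mul_comm]

theorem SmoothFn.dirDeriv_eq_zero_of_const {f : SmoothFn E M} {c : ℝ} (hf : ∀ m, f m = c)
    (V : SmoothVF E M) (m : M) : f.dirDeriv V m = 0 := by
  obtain ⟨e, x, v, -, h⟩ := SmoothFn.exists_dirDeriv_eq V m
  have h1 : f ∘ e.symm = fun _ => c := funext fun y => hf _
  rw [(h f).2, h1]
  simp

theorem SmoothVF.smulFn_lie_apply (f : SmoothFn E M) (X V : SmoothVF E M) (m : M) :
    ⁅f • X, V⁆ m = f m • ⁅X, V⁆ m - f.dirDeriv V m • X m := by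
  have := FiniteDimensional.complete ℝ E
  have : IsManifold 𝓘(ℝ, E) 2 M := IsManifold.of_le (n := ∞) two_le_smooth
  have h := mlieBracket_smul_left (V := X) (W := V) (f := f)
    ((f.contMDiff m).mdifferentiableAt (by simp)) (X.mdifferentiableAt m)
  refine h.trans ?_
  rw [sub_eq_neg_add, ← neg_smul]
  rfl

theorem SmoothVF.lie_smulFn_apply (f : SmoothFn E M) (X V : SmoothVF E M) (m : M) :
    ⁅V, f • X⁆ m = f m • ⁅V, X⁆ m + f.dirDeriv V m • X m := by
  have h1 : ⁅V, f • X⁆ m = -⁅f • X, V⁆ m := by rw [← lie_skew]; rfl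
  have h2 : ⁅V, X⁆ m = -⁅X, V⁆ m := by rw [← lie_skew]; rfl
  rw [h1, h2, SmoothVF.smulFn_lie_apply, smul_neg, neg_sub, sub_eq_neg_add]

end DirDeriv

namespace RegularFoliation

variable {E : Type*} [NormedAddCommGroup E] [NormedSpace ℝ E] [FiniteDimensional ℝ E]
  {M : Type*} [TopologicalSpace M] [ChartedSpace E M] [IsManifold 𝓘(ℝ, E) ∞ M]
  {F : RegularFoliation E M}

/-! ### Tensoriality of the curvature of the associated connection -/

namespace Connection

variable (C : F.Connection)

theorem bar_add_left (X Y : F.sections) (V : SmoothVF E M) :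
    C.bar (X + Y) V = C.bar X V + C.bar Y V := by
  unfold bar
  rw [C.add_right, sections_coe_add, sections_coe_add, add_lie]
  abel

theorem bar_sub_left (X Y : F.sections) (V : SmoothVF E M) :
    C.bar (X - Y) V = C.bar X V - C.bar Y V := by
  rw [eq_sub_iff_add_eq, ← C.bar_add_left, sub_add_cancel]

theorem bar_add_right (X : F.sections) (V W : SmoothVF E M) :
    C.bar X (V + W) = C.bar X V + C.bar X W := by
  unfold bar
  rw [C.add_left, sections_coe_add, lie_add]
  abel

/-- The term `df(V) X` from the Leibniz rule for `∇` cancels the one from `[f X, V]`; this is why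
`∇̄` is a connection along `D`. -/
theorem bar_smulFn_left (f : SmoothFn E M) (X : F.sections) (V : SmoothVF E M) :
    C.bar (f • X) V = f • C.bar X V := by
  ext m
  have h : (C.bar (f • X) V) m = (C.cov V (f • X) : SmoothVF E M) m
    + ⁅f • (X : SmoothVF E M), V⁆ m := rfl
  have h' : (f • C.bar X V) m = f m • ((C.cov V X : SmoothVF E M) m
    + ⁅(X : SmoothVF E M), V⁆ m) := rfl
  rw [h, h', C.leibniz, SmoothVF.smulFn_lie_apply, smul_add]
  abel

theorem bar_smulFn_right (f : SmoothFn E M) (X : F.sections) (V : SmoothVF E M) :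
    C.bar X (f • V) = f • C.bar X V + f.lieDeriv (X : SmoothVF E M) • V := by
  ext m
  have h : (C.bar X (f • V)) m = (C.cov (f • V) X : SmoothVF E M) m
    + ⁅(X : SmoothVF E M), f • V⁆ m := rfl
  have h' : (f • C.bar X V + f.lieDeriv (X : SmoothVF E M) • V) m
    = f m • ((C.cov V X : SmoothVF E M) m + ⁅(X : SmoothVF E M), V⁆ m)
      + f.dirDeriv (X : SmoothVF E M) m • V m := rfl
  have h2 : (C.cov (f • V) X : SmoothVF E M) m = f m • (C.cov V X : SmoothVF E M) m := by
    rw [C.smul_left]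
    rfl
  rw [h, h', h2, SmoothVF.lie_smulFn_apply, smul_add]
  abel

theorem smulFn_lie_sections (f : SmoothFn E M) (X Y : F.sections) :
    ⁅f • X, Y⁆ = f • ⁅X, Y⁆ - f.lieDeriv (Y : SmoothVF E M) • X := by
  apply Subtype.ext
  ext m
  exact SmoothVF.smulFn_lie_apply f X Y m

/-- The vanishing of the curvature of the associated connection for two given sections. -/
def BarCurvZero (X Y : F.sections) : Prop :=
  ∀ V : SmoothVF E M, C.bar X (C.bar Y V) - C.bar Y (C.bar X V) - C.bar ⁅X, Y⁆ V = 0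

variable {C}

/-- The curvature is antisymmetric, so linearity in the first section suffices for both. -/
theorem BarCurvZero.symm {X Y : F.sections} (h : C.BarCurvZero X Y) : C.BarCurvZero Y X := by
  intro V
  have h1 : ⁅Y, X⁆ = (0 : F.sections) - ⁅X, Y⁆ := by rw [zero_sub, lie_skew]
  have h2 : C.bar 0 V = 0 := by simpa using C.bar_sub_left 0 0 V
  rw [h1, bar_sub_left, h2, ← neg_eq_zero]
  exact Eq.trans (by abel) (h V)

theorem BarCurvZero.add {X X' Y : F.sections} (h : C.BarCurvZero X Y) (h' : C.BarCurvZero X' Y) :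
    C.BarCurvZero (X + X') Y := by
  intro V
  have h1 := h V
  have h2 := h' V
  rw [bar_add_left, bar_add_left, bar_add_right, add_lie, bar_add_left]
  rw [← add_zero (0 : SmoothVF E M)]
  nth_rewrite 1 [← h1]
  rw [← h2]
  abel

/-- The derivative of `f` along `Y` enters once through the Leibniz rule of `∇̄_Y` and once through
`[f X, Y]`, and the two contributions cancel. -/
theorem BarCurvZero.smulFn {X Y : F.sections} (h : C.BarCurvZero X Y) (f : SmoothFn E M) :
    C.BarCurvZero (f • X) Y := by
  intro V
  rw [bar_smulFn_left, bar_smulFn_left, bar_smulFn_right, smulFn_lie_sections, bar_sub_left,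
    bar_smulFn_left, bar_smulFn_left]
  ext m
  have h1 : (C.bar X (C.bar Y V)) m - (C.bar Y (C.bar X V)) m - (C.bar ⁅X, Y⁆ V) m = 0 :=
    congrArg (fun Z : SmoothVF E M => Z m) (h V)
  have h2 : f m • (C.bar X (C.bar Y V)) m - f m • (C.bar Y (C.bar X V)) m
      - f m • (C.bar ⁅X, Y⁆ V) m = 0 := by
    rw [← smul_sub, ← smul_sub, h1, smul_zero]
  change f m • (C.bar X (C.bar Y V)) m - (f m • (C.bar Y (C.bar X V)) m
      + f.dirDeriv (Y : SmoothVF E M) m • (C.bar X V) m)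
    - (f m • (C.bar ⁅X, Y⁆ V) m - f.dirDeriv (Y : SmoothVF E M) m • (C.bar X V) m) = 0
  rw [← h2]
  abel

theorem BarCurvZero.sum {ι : Type*} (s : Finset ι) {X : ι → F.sections} {Y : F.sections}
    (h : ∀ i, C.BarCurvZero (X i) Y) : C.BarCurvZero (∑ i ∈ s, X i) Y := by
  classical
  induction s using Finset.induction_on with
  | empty =>
    intro V
    have h2 (W : SmoothVF E M) : C.bar 0 W = 0 := by simpa using C.bar_sub_left 0 0 W
    have h3 : C.bar Y 0 = 0 := by simpa using C.bar_add_right Y 0 0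
    simp [h2, h3]
  | insert i s hi ih =>
    rw [Finset.sum_insert hi]
    exact (h i).add ih

theorem bar_of_cov_eq_zero {X : F.sections} {V : SmoothVF E M} (h : C.cov V X = 0) :
    C.bar X V = ⁅(X : SmoothVF E M), V⁆ := by
  unfold bar
  rw [h]
  exact zero_add _

/-- The curvature of the associated connection vanishes on parallel sections with parallel
bracket. -/
theorem barCurvZero_of_parallel {X Y : F.sections} (hX : ∀ V, C.cov V X = 0)
    (hY : ∀ V, C.cov V Y = 0) (hXY : ∀ V, C.cov V ⁅X, Y⁆ = 0) : C.BarCurvZero X Y := by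
  intro V
  rw [bar_of_cov_eq_zero (hX _), bar_of_cov_eq_zero (hY _), bar_of_cov_eq_zero (hX _),
    bar_of_cov_eq_zero (hY _), bar_of_cov_eq_zero (hXY _), LieSubalgebra.coe_bracket, leibniz_lie]
  abel

end Connection

/-! ### The flat connection defined by a global frame -/

section Frame

theorem sections_sum_smulFn_apply {n : ℕ} (f : Fin n → SmoothFn E M) (X : Fin n → F.sections)
    (m : M) : ((∑ i, f i • X i : F.sections) : SmoothVF E M) m
      = ∑ i, f i m • (X i : SmoothVF E M) m := by
  rw [sections_coe_sum]
  have h : ∀ s : Finset (Fin n), (∑ i ∈ s, ((f i • X i : F.sections) : SmoothVF E M)) m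
      = ∑ i ∈ s, f i m • (X i : SmoothVF E M) m := by
    intro s
    induction s using Finset.induction_on with
    | empty => rfl
    | insert i s hi ih =>
      rw [Finset.sum_insert hi, Finset.sum_insert hi, ← ih]
      rfl
  exact h _

theorem eq_of_frame_sum_eq {n : ℕ} {X : Fin n → F.sections}
    (hX : ∀ m (c : Fin n → ℝ), ∑ i, c i • (X i : SmoothVF E M) m = 0 → c = 0) {m : M}
    {c c' : Fin n → ℝ}
    (h : ∑ i, c i • (X i : SmoothVF E M) m = ∑ i, c' i • (X i : SmoothVF E M) m) : c = c' := by
  rw [← sub_eq_zero]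
  refine hX m _ ?_
  simp only [Pi.sub_apply, sub_smul, Finset.sum_sub_distrib, h, sub_self]

/-- Pointwise coefficients exist by spanning; independence makes them solutions of linear equations
with injective smooth coefficients, hence smooth. -/
theorem exists_smooth_frame_coeff {n : ℕ} {X : Fin n → F.sections}
    (hX : ∀ m (c : Fin n → ℝ), ∑ i, c i • (X i : SmoothVF E M) m = 0 → c = 0)
    (hspan : ∀ m, ∀ v ∈ F.tangent m, ∃ c : Fin n → ℝ, ∑ i, c i • (X i : SmoothVF E M) m = v)
    (Y : F.sections) : ∃ f : Fin n → SmoothFn E M, Y = ∑ i, f i • X i := by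
  choose c hc using fun m => hspan m _ (Y.2 m)
  have hsm (i : Fin n) : ContMDiff 𝓘(ℝ, E) 𝓘(ℝ, ℝ) ∞ fun m => c m i := by
    intro m
    have he := IsManifold.chart_mem_maximalAtlas (I := 𝓘(ℝ, E)) (n := ∞) m
    set e := chartAt E m
    have hm : m ∈ e.source := mem_chart_source E m
    have hx := e.map_source hm
    have h1 : ContDiffAt ℝ ∞ (fun x => c (e.symm x)) (e m) := by
      refine contDiffAt_frame_coeff he (X := fun i => (X i : SmoothVF E M)) hX hx
        (contDiffAt_chartRep he (Y : SmoothVF E M) hx) ?_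
      filter_upwards [e.open_target.mem_nhds hx] with x hxt
      have h2 := frameRep_eq_mfderiv (e.map_target hxt) (fun i => (X i : SmoothVF E M))
        (c (e.symm x))
      rw [e.right_inv hxt, hc] at h2
      exact h2
    have h3 : ContMDiffAt 𝓘(ℝ, E) 𝓘(ℝ, ℝ) ∞ ((fun x => c (e.symm x) i) ∘ e) m :=
      (contDiffAt_pi.1 h1 i).contMDiffAt.comp m (contMDiffAt_of_mem_maximalAtlas he hm)
    refine h3.congr_of_eventuallyEq ?_
    filter_upwards [e.open_source.mem_nhds hm] with y hy
    simp [e.left_inv hy]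
  let g : Fin n → SmoothFn E M := fun i => ⟨fun m => c m i, hsm i⟩
  refine ⟨g, Subtype.ext (ContMDiffSection.ext fun m => ?_)⟩
  exact (hc m).symm.trans (sections_sum_smulFn_apply g X m).symm

/-- A global frame with constant structure coefficients determines a flat connection with flat
associated connection. -/
theorem exists_flat_connection_of_frame {n : ℕ} {X : Fin n → F.sections}
    (hX : ∀ m (c : Fin n → ℝ), ∑ i, c i • (X i : SmoothVF E M) m = 0 → c = 0)
    (hspan : ∀ m, ∀ v ∈ F.tangent m, ∃ c : Fin n → ℝ, ∑ i, c i • (X i : SmoothVF E M) m = v)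
    (hbr : ∀ i j, ∃ c : Fin n → ℝ, ⁅X i, X j⁆ = ∑ l, c l • X l) :
    ∃ C : F.Connection, C.IsFlat ∧ C.BarIsFlat := by
  choose f hf using exists_smooth_frame_coeff hX hspan
  have hfm (Y : F.sections) (m : M) :
      ∑ i, f Y i m • (X i : SmoothVF E M) m = (Y : SmoothVF E M) m := by
    rw [← sections_sum_smulFn_apply, ← hf]
  have huniq {Y : F.sections} {g : Fin n → SmoothFn E M}
      (h : ∀ m, ∑ i, g i m • (X i : SmoothVF E M) m = (Y : SmoothVF E M) m) (i : Fin n) :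
      f Y i = g i := by
    ext m
    exact congrFun (eq_of_frame_sum_eq hX (m := m) (c := fun i => f Y i m) (c' := fun i => g i m)
      ((hfm Y m).trans (h m).symm)) i
  have hadd (Y Z : F.sections) (i) : f (Y + Z) i = f Y i + f Z i := by
    refine huniq (g := fun i => f Y i + f Z i) (fun m => ?_) i
    refine Eq.trans ?_ (congrArg₂ (· + ·) (hfm Y m) (hfm Z m))
    rw [← Finset.sum_add_distrib]
    exact Finset.sum_congr rfl fun i _ => add_smul _ _ _
  have hsmul (g : SmoothFn E M) (Y : F.sections) (i) : f (g • Y) i = g * f Y i := by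
    refine huniq (g := fun i => g * f Y i) (fun m => ?_) i
    refine Eq.trans ?_ (congrArg (g m • ·) (hfm Y m))
    rw [Finset.smul_sum]
    exact Finset.sum_congr rfl fun i _ => mul_smul _ _ _
  -- The connection for which the frame is parallel: only the coefficients are differentiated.
  let cov (V : SmoothVF E M) (Y : F.sections) : F.sections := ∑ i, (f Y i).lieDeriv V • X i
  have hcov (V : SmoothVF E M) (Y : F.sections) (m : M) : (cov V Y : SmoothVF E M) m =
      ∑ i, (f Y i).dirDeriv V m • (X i : SmoothVF E M) m := sections_sum_smulFn_apply _ _ _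
  have hfcov (V : SmoothVF E M) (Y : F.sections) (i) : f (cov V Y) i = (f Y i).lieDeriv V :=
    huniq (g := fun i => (f Y i).lieDeriv V) (fun m => (hcov V Y m).symm) i
  let C : F.Connection :=
    { cov := cov
      add_left := fun V W Y => by
        apply Subtype.ext
        ext m
        refine (hcov _ _ m).trans (Eq.trans ?_ (congrArg₂ (· + ·) (hcov V Y m) (hcov W Y m)).symm)
        simp only [SmoothFn.dirDeriv_add_right, add_smul, Finset.sum_add_distrib]
      smul_left := fun g V Y => by
        apply Subtype.ext
        ext m
        refine (hcov _ _ m).trans (Eq.trans ?_ (congrArg (g m • ·) (hcov V Y m)).symm)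
        simp only [SmoothFn.dirDeriv_smulFn_right, mul_smul, Finset.smul_sum]
      add_right := fun V Y Z => by
        apply Subtype.ext
        ext m
        refine (hcov _ _ m).trans (Eq.trans ?_ (congrArg₂ (· + ·) (hcov V Y m) (hcov V Z m)).symm)
        simp only [hadd, SmoothFn.dirDeriv_add_left, add_smul, Finset.sum_add_distrib]
      leibniz := fun g V Y m => by
        rw [hcov, hcov, ← hfm Y m, Finset.smul_sum, Finset.smul_sum, ← Finset.sum_add_distrib]
        refine Finset.sum_congr rfl fun i _ => ?_
        rw [hsmul, SmoothFn.dirDeriv_mul_left, add_smul, mul_smul, mul_smul] }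
  have hpar (V : SmoothVF E M) (l : Fin n) : C.cov V (X l) = 0 := by
    apply Subtype.ext
    ext m
    refine (hcov V (X l) m).trans (Finset.sum_eq_zero fun i _ => ?_)
    have h1 : f (X l) i = ⟨fun _ => Pi.single (M := fun _ => ℝ) l 1 i, contMDiff_const⟩ := by
      refine huniq (g := fun i => ⟨fun _ => Pi.single (M := fun _ => ℝ) l 1 i, contMDiff_const⟩)
        (fun m => ?_) i
      change ∑ i, (Pi.single (M := fun _ => ℝ) l 1 i) • (X i : SmoothVF E M) m = _
      rw [Finset.sum_eq_single l]
      · simp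
      · intro i _ hi
        rw [Pi.single_eq_of_ne hi, zero_smul]
      · simp
    rw [SmoothFn.dirDeriv_eq_zero_of_const (fun m => by rw [h1]; rfl) V m, zero_smul]
  refine ⟨C, fun V W Y => ?_, fun Y Z => ?_⟩
  · apply Subtype.ext
    ext m
    have h1 : (cov V (cov W Y) : SmoothVF E M) m - (cov W (cov V Y) : SmoothVF E M) m
        - (cov ⁅V, W⁆ Y : SmoothVF E M) m = 0 := by
      -- In the frame, the curvature acts on each coefficient by `V W - W V - [V, W]`, which is zero
      -- on functions.
      rw [hcov, hcov, hcov, ← Finset.sum_sub_distrib, ← Finset.sum_sub_distrib]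
      refine Finset.sum_eq_zero fun i _ => ?_
      rw [hfcov, hfcov, SmoothFn.dirDeriv_bracket, ← sub_smul, ← sub_smul, sub_self, zero_smul]
    exact h1
  · have hframe (i j) : C.BarCurvZero (X i) (X j) := by
      refine Connection.barCurvZero_of_parallel (fun V => hpar V i) (fun V => hpar V j) fun V => ?_
      obtain ⟨c, hc⟩ := hbr i j
      rw [hc, C.cov_sum_right]
      refine Finset.sum_eq_zero fun l _ => ?_
      rw [C.cov_const_smul_right, hpar, smul_zero]
    -- Tensoriality extends the vanishing from frame fields to all sections in the first slot;
    -- applying it twice, with antisymmetry in between, covers both slots.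
    have hcomb {W : F.sections} (hW : ∀ i, C.BarCurvZero (X i) W) (Y : F.sections) :
        C.BarCurvZero Y W := by
      rw [hf Y]
      exact Connection.BarCurvZero.sum _ fun i => (hW i).smulFn _
    exact hcomb (fun i => (hcomb (fun j => hframe j i) Z).symm) Y

end Frame

end RegularFoliation

/-! ### The two implications -/

section Equivalence

variable {E : Type*} [NormedAddCommGroup E] [NormedSpace ℝ E] [FiniteDimensional ℝ E]
  {M : Type*} [TopologicalSpace M] [ChartedSpace E M] [IsManifold 𝓘(ℝ, E) ∞ M]
  {F : RegularFoliation E M}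

/-- The evaluation at a point of the vector fields generated by an action. -/
def LieAlgAction.evalOrbit {𝔤 : Type*} [LieRing 𝔤] [LieAlgebra ℝ 𝔤] (A : LieAlgAction 𝔤 E M)
    (m : M) : 𝔤 →ₗ[ℝ] A.orbitTangent m where
  toFun ξ := ⟨A ξ m, ξ, rfl⟩
  map_add' ξ η := Subtype.ext (congrArg (fun Z : SmoothVF E M => Z m) (map_add A ξ η))
  map_smul' c ξ := Subtype.ext (congrArg (fun Z : SmoothVF E M => Z m) (map_smul A c ξ))

theorem LieAlgAction.evalOrbit_surjective {𝔤 : Type*} [LieRing 𝔤] [LieAlgebra ℝ 𝔤]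
    (A : LieAlgAction 𝔤 E M) (m : M) : Function.Surjective (A.evalOrbit m) := by
  rintro ⟨_, ξ, rfl⟩
  exact ⟨ξ, rfl⟩

/-- A basis of the Lie algebra becomes a global frame of `D`, and its structure constants become the
constant bracket coefficients of the frame. -/
theorem exists_flat_connection_of_action {𝔤 : Type*} [LieRing 𝔤] [LieAlgebra ℝ 𝔤]
    [FiniteDimensional ℝ 𝔤] {A : LieAlgAction 𝔤 E M} (hfree : A.IsFree)
    (hA : ∀ m, A.orbitTangent m = F.tangent m) : ∃ C : F.Connection, C.IsFlat ∧ C.BarIsFlat := by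
  have hfin (m : M) : FiniteDimensional ℝ (A.orbitTangent m) :=
    Module.Finite.of_surjective _ (A.evalOrbit_surjective m)
  -- Evaluation maps onto the orbit's tangent space, which by freeness has the dimension of the Lie
  -- algebra, so it is also injective.
  have hinj (m : M) : Function.Injective (A.evalOrbit m) :=
    (LinearMap.injective_iff_surjective_of_finrank_eq_finrank (hfree m).symm).2
      (A.evalOrbit_surjective m)
  set b := Module.finBasis ℝ 𝔤
  have hmem (ξ : 𝔤) : A ξ ∈ F.sections := fun m => hA m ▸ ⟨ξ, rfl⟩
  let L : 𝔤 →ₗ[ℝ] F.sections := (A : 𝔤 →ₗ[ℝ] SmoothVF E M).codRestrict F.sections.toSubmodule hmem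
  have hsum (c : Fin (Module.finrank ℝ 𝔤) → ℝ) (m : M) :
      ∑ i, c i • (L (b i) : SmoothVF E M) m = (A.evalOrbit m (∑ i, c i • b i)).1 := by
    rw [map_sum, AddSubmonoidClass.coe_finsetSum]
    refine Finset.sum_congr rfl fun i _ => ?_
    rw [map_smul]
    rfl
  refine RegularFoliation.exists_flat_connection_of_frame (X := fun i => L (b i)) (fun m c hc => ?_)
    (fun m v hv => ?_) fun i j => ⟨fun l => b.repr ⁅b i, b j⁆ l, ?_⟩
  · rw [hsum] at hc
    have h1 : ∑ i, c i • b i = 0 := hinj m (by rw [map_zero]; exact Subtype.ext hc)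
    funext i
    exact Fintype.linearIndependent_iff.1 b.linearIndependent c h1 i
  · rw [← hA] at hv
    obtain ⟨ξ, hξ⟩ := A.evalOrbit_surjective m ⟨v, hv⟩
    refine ⟨fun i => b.repr ξ i, ?_⟩
    rw [hsum, b.sum_repr, hξ]
  · simp only [← map_smul, ← map_sum, b.sum_repr]
    exact Subtype.ext (A.map_lie (b i) (b j)).symm

/-- The parallel sections act tautologically. Evaluation at every point is a bijection onto the
tangent space of the leaf, which yields freeness, the tangent spaces and, through `orbit_eq_leaf`,
the orbits. -/
theorem exists_action_of_flat_connection [T2Space M] [SimplyConnectedSpace M] {C : F.Connection}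
    (hC : C.IsFlat) (hbar : C.BarIsFlat) :
    ∃ (𝔤 : Type) (_ : LieRing 𝔤) (_ : LieAlgebra ℝ 𝔤) (_ : FiniteDimensional ℝ 𝔤)
      (A : LieAlgAction 𝔤 E M), A.IsFree ∧ A.OrbitsAreLeaves F := by
  let 𝔭 := RegularFoliation.Connection.parallelSections hbar
  have hinj (X : 𝔭) (m : M) (h : (X : SmoothVF E M) m = 0) : X = 0 := by
    obtain ⟨X, hX, hpar⟩ := X
    apply Subtype.ext
    ext y
    exact C.eq_zero_of_parallel (X := ⟨X, hX⟩) (fun m V => by rw [hpar V]; rfl) h y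
  have hsurj (m : M) (v : TangentSpace 𝓘(ℝ, E) m) (hv : v ∈ F.tangent m) :
      ∃ X : 𝔭, (X : SmoothVF E M) m = v := by
    obtain ⟨X, hXm, hX⟩ := C.exists_global_parallel hC m hv
    exact ⟨⟨X, X.2, fun V => Subtype.ext (ContMDiffSection.ext fun m => hX m V)⟩, hXm⟩
  obtain ⟨m₀⟩ : Nonempty M := inferInstance
  -- A parallel section is determined by its value at one point, so evaluation embeds the Lie
  -- algebra into the model space.
  have : FiniteDimensional ℝ 𝔭 := by
    let ev : 𝔭 →ₗ[ℝ] E :=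
      { toFun := fun X => (X : SmoothVF E M) m₀
        map_add' := fun _ _ => rfl
        map_smul' := fun _ _ => rfl }
    refine FiniteDimensional.of_injective ev ((injective_iff_map_eq_zero ev).2 fun X hX => ?_)
    exact hinj X m₀ hX
  -- The parallel sections live in the universes of `E` and `M`; an isomorphic Lie algebra on a
  -- coordinate space lies in `Type`.
  obtain ⟨𝔤, i1, i2, i3, ⟨φ⟩⟩ := exists_lieEquiv_type 𝔭
  let A : LieAlgAction 𝔤 E M := 𝔭.incl.comp φ.toLieHom
  have hAinj (ξ : 𝔤) (m : M) (h : A ξ m = 0) : ξ = 0 := by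
    have := hinj (φ ξ) m h
    exact φ.injective (this.trans (map_zero φ).symm)
  have hAmem (ξ : 𝔤) (m : M) : A ξ m ∈ F.tangent m := (φ ξ).2.1 m
  have hAspan (m : M) (v) (hv : v ∈ F.tangent m) : ∃ ξ, A ξ m = v := by
    obtain ⟨X, hX⟩ := hsurj m v hv
    refine ⟨φ.symm X, ?_⟩
    change ((φ (φ.symm X) : 𝔭) : SmoothVF E M) m = v
    rw [φ.apply_symm_apply, hX]
  refine ⟨𝔤, i1, i2, i3, A, fun m => ?_, fun m => ⟨?_, ?_⟩⟩
  · refine (LinearEquiv.finrank_eq (LinearEquiv.ofBijective (A.evalOrbit m)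
      ⟨(injective_iff_map_eq_zero _).2 fun ξ hξ => ?_, A.evalOrbit_surjective m⟩)).symm
    exact hAinj ξ m (congrArg Subtype.val hξ)
  · exact LieAlgAction.orbit_eq_leaf hAinj hAmem hAspan m
  · ext v
    exact ⟨fun ⟨ξ, hξ⟩ => hξ ▸ hAmem ξ m, fun hv => hAspan m v hv⟩

end Equivalence

end

/-- Let `F` be a regular foliation, with tangent distribution `D`, on a simply connected manifold
`M`. The leaves of `F` are the orbits of a free Lie algebra action if and only if `D` admits a flat
connection `∇` whose associated `D`-connection `∇̄_X V = ∇_V X + [X, V]` is also flat. -/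
theorem corollary3p2 {E : Type*} [NormedAddCommGroup E] [NormedSpace ℝ E] [FiniteDimensional ℝ E]
    {M : Type*} [TopologicalSpace M] [ChartedSpace E M] [IsManifold 𝓘(ℝ, E) ∞ M]
    [T2Space M] [SecondCountableTopology M] [SimplyConnectedSpace M]
    (F : RegularFoliation E M) :
    (∃ (𝔤 : Type) (_ : LieRing 𝔤) (_ : LieAlgebra ℝ 𝔤) (_ : FiniteDimensional ℝ 𝔤)
        (A : LieAlgAction 𝔤 E M), A.IsFree ∧ A.OrbitsAreLeaves F) ↔
      ∃ C : F.Connection, C.IsFlat ∧ C.BarIsFlat := by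
  constructor
  · rintro ⟨𝔤, _, _, _, A, hfree, hA⟩
    exact exists_flat_connection_of_action hfree fun m => (hA m).2
  · rintro ⟨C, hC, hbar⟩
    exact exists_action_of_flat_connection hC hbar
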